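/- For $a,b\in\mathbb R$ let $F_{a,b}:\mathbb R^2\to\mathbb R^2$, $F_{a,b}(x,y)=(|x|-y+a,\;x-|y|+b)$. For $a<0$, an \emph{invariant graph} of $F_{a,b}$ is a nonempty compact graph $\Gamma\subset\mathbb R^2$ with straight edges (a finite union of closed segments, possibly degenerate to points) such that $F_{a,b}(\Gamma)\subset\Gamma$ and, for some finite (possibly empty) set $E$ of periodic points of $F_{a,b}$, for every $\mathbf x\in\mathbb R^2$ there is $n\ge 0$ with $F_{a,b}^n(\mathbf x)\in\Gamma\cup E$. Write $c=-b/a$. There is a function $h_F:\mathbb R\to\mathbb R$ such that for all $a<0$, $b\in\mathbb R$ and every invariant graph $\Gamma$ of $F_{a,b}$, the topological entropy of $F_{a,b}|_\Gamma$ equals $h_F(c)$; for $c>4$ such an invariant graph exists (so $h_F(c)$ is uniquely determined there). The entropy function $h_F$ is continuous at $c=8$. -/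

import Mathlib

open Filter Topology Set

/-- The piecewise linear map `F(x,y) = (|x| - y + a, x - |y| + b)` of the plane. -/
def planeMap (a b : ℝ) (p : ℝ × ℝ) : ℝ × ℝ :=
  (|p.1| - p.2 + a, p.1 - |p.2| + b)

/-- A compact graph with straight edges in the plane: a finite union of closed segments
(a degenerate segment is a point, so isolated vertices are allowed). -/
def IsCompactGraph (Γ : Set (ℝ × ℝ)) : Prop :=
  ∃ S : Finset ((ℝ × ℝ) × (ℝ × ℝ)), Γ = ⋃ s ∈ S, segment ℝ s.1 s.2

/-- `Γ` is an invariant graph capturing the dynamics of `planeMap a b`: it is a nonempty compact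
graph, the map sends it into itself, and every orbit of the plane enters `Γ`, or a finite
exceptional set of periodic points. (A repelling fixed point may lie off the
one-dimensional part of the graph; with `E = ∅` every orbit has to enter `Γ` itself.) -/
structure IsInvariantGraph (a b : ℝ) (Γ : Set (ℝ × ℝ)) : Prop where
  graph : IsCompactGraph Γ
  nonempty : Γ.Nonempty
  invariant : MapsTo (planeMap a b) Γ Γ
  absorbing : ∃ E : Set (ℝ × ℝ), E.Finite ∧ E ⊆ Function.periodicPts (planeMap a b) ∧
    ∀ x : ℝ × ℝ, ∃ n : ℕ, (planeMap a b)^[n] x ∈ Γ ∪ E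

/-! The entropy tends to 0 as c tends to 8, and its value at 8 is 0. Entropy on a nonempty set is
nonnegative, so only upper bounds are needed. Rescaling the plane reduces everything to a = -1, b =
c.

Independence of the graph: a compact invariant set carries no more entropy than an invariant set
that all its orbits enter (`coverEntropy_le_of_forall_exists_iterate_mem`), and finitely many
periodic orbits add nothing. For c > 4 an explicit graph of five segments works. The map collapses
the first and third quadrants onto lines, and only the repelling fixed point stays in the second
quadrant forever.

Upper bound: the map is affine on each quadrant, so entropy on a graph is at most the growth rate of
the number of itineraries (`coverEntropy_le_of_itineraries`). If itineraries break 3-periodicity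
with frequency at most δ, that rate is at most log(1 + 4z) - δ log z for every z in (0, 1].

Rarity of deviations: points (t - 1, t + c) return to their line after three or four steps by a
piecewise affine map of t. It is constant on [-c, -c/2] and equals 4t + c + 1 on [-c/2, -1/2], with
repelling fixed point -(c + 1)/3. Points with t ≥ -1/2 come back at height at most 5 - c, which
exceeds the fixed point by 2(8 - c)/3. This gap closes at c = 8. Near 8 a returning orbit is
therefore either caught in the constant branch, or stays 3-periodic for a long time beside the
repelling point. -/

/-! ### Entropy through labellings of orbit segments -/

section Entropy

variable {X : Type*}

/-- The number of times `k < n` at which the orbit of `x` satisfies `P`. -/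
noncomputable def hits (T : X → X) (P : X → Prop) (x : X) (n : ℕ) : ℕ :=
  open Classical in ∑ k ∈ Finset.range n, if P (T^[k] x) then 1 else 0

lemma hits_zero (T : X → X) (P : X → Prop) (x : X) : hits T P x 0 = 0 := by simp [hits]

lemma hits_add (T : X → X) (P : X → Prop) (x : X) (m n : ℕ) :
    hits T P x (m + n) = hits T P x m + hits T P (T^[m] x) n := by
  rw [hits, Finset.sum_range_add]
  refine congrArg₂ _ rfl (Finset.sum_congr rfl fun k _ => ?_)
  rw [Nat.add_comm m k, Function.iterate_add_apply]

lemma hits_le (T : X → X) (P : X → Prop) (x : X) (n : ℕ) : hits T P x n ≤ n := by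
  classical
  refine (Finset.sum_le_card_nsmul _ _ 1 fun k _ => ?_).trans (by simp)
  split_ifs <;> simp

lemma hits_mono (T : X → X) (P : X → Prop) (x : X) {m n : ℕ} (h : m ≤ n) :
    hits T P x m ≤ hits T P x n := by
  obtain ⟨k, rfl⟩ := Nat.exists_eq_add_of_le h
  rw [hits_add]; omega

lemma hits_succ (T : X → X) (P : X → Prop) (x : X) (n : ℕ) [Decidable (P x)] :
    hits T P x (n + 1) = (if P x then 1 else 0) + hits T P (T x) n := by
  rw [Nat.add_comm, hits_add]
  congr 1
  rw [hits, Finset.sum_range_one]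
  by_cases h : P x <;> simp [h]

variable [MetricSpace X]

/-- The points of `S` can be labelled by `k` labels so that the orbits of length `n` of points
with the same label are `ε`-close. -/
def HasLabelling (T : X → X) (S : Set X) (ε : ℝ) (n k : ℕ) : Prop :=
  ∃ l : X → ℕ, (∀ x ∈ S, l x < k) ∧
    ∀ x ∈ S, ∀ y ∈ S, l x = l y → ∀ j < n, dist (T^[j] x) (T^[j] y) < ε

lemma HasLabelling.mono {T : X → X} {S S' : Set X} {ε : ℝ} {n n' k : ℕ}
    (h : HasLabelling T S ε n k) (hS : S' ⊆ S) (hn : n' ≤ n) : HasLabelling T S' ε n' k := by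
  obtain ⟨l, h1, h2⟩ := h
  exact ⟨l, fun x hx => h1 x (hS hx), fun x hx y hy hl j hj =>
    h2 x (hS hx) y (hS hy) hl j (hj.trans_le hn)⟩

/-- The second family of labels is shifted by `k` to keep it apart from the first; a point of both
sets uses the first. -/
lemma HasLabelling.union {T : X → X} {S S' : Set X} {ε : ℝ} {n k k' : ℕ}
    (h : HasLabelling T S ε n k) (h' : HasLabelling T S' ε n k') :
    HasLabelling T (S ∪ S') ε n (k + k') := by
  classical
  obtain ⟨l, h1, h2⟩ := h
  obtain ⟨l', h1', h2'⟩ := h'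
  refine ⟨fun x => if x ∈ S then l x else k + l' x, ?_, ?_⟩
  · rintro x (hx | hx)
    · have := h1 x hx
      simp only [hx, if_true]; omega
    · have := h1' x hx
      by_cases hS : x ∈ S
      · have := h1 x hS
        simp only [hS, if_true]; omega
      · simp only [hS, if_false]; omega
  · intro x hx y hy hl
    by_cases hxS : x ∈ S <;> by_cases hyS : y ∈ S
    · simp only [hxS, hyS, if_true] at hl
      exact h2 x hxS y hyS hl
    · have := h1 x hxS
      simp only [hxS, hyS, if_true, if_false] at hl; omega
    · have := h1 y hyS
      simp only [hxS, hyS, if_true, if_false] at hl; omega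
    · simp only [hxS, hyS, if_false] at hl
      exact h2' x (hx.resolve_left hxS) y (hy.resolve_left hyS) (by omega)

/-- The pair of labels, one for the first m steps and one for the rest, is coded as a two-digit
number in base `k'`. -/
lemma HasLabelling.concat {T : X → X} {S : Set X} {ε : ℝ} {m n k k' : ℕ}
    (h : HasLabelling T S ε m k) (h' : HasLabelling T (T^[m] '' S) ε n k') :
    HasLabelling T S ε (m + n) (k * k') := by
  obtain ⟨l, h1, h2⟩ := h
  obtain ⟨l', h1', h2'⟩ := h'
  have hlt : ∀ x ∈ S, l' (T^[m] x) < k' := fun x hx => h1' _ (mem_image_of_mem _ hx)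
  refine ⟨fun x => l' (T^[m] x) + k' * l x, ?_, ?_⟩
  · intro x hx
    have a := h1 x hx
    have b := hlt x hx
    calc l' (T^[m] x) + k' * l x < k' + k' * l x := by omega
      _ = k' * (l x + 1) := by ring
      _ ≤ k' * k := Nat.mul_le_mul_left _ a
      _ = k * k' := Nat.mul_comm _ _
  · intro x hx y hy hl j hj
    have hlx := hlt x hx
    have hly := hlt y hy
    simp only at hl
    have e1 : l' (T^[m] x) = l' (T^[m] y) := by
      have := congrArg (· % k') hl
      simpa [Nat.add_mul_mod_self_left, Nat.mod_eq_of_lt hlx, Nat.mod_eq_of_lt hly] using this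
    have e2 : l x = l y := by
      rw [e1] at hl
      exact Nat.eq_of_mul_eq_mul_left (by omega) (Nat.add_left_cancel hl)
    rcases lt_or_ge j m with hjm | hjm
    · exact h2 x hx y hy e2 j hjm
    · obtain ⟨i, rfl⟩ := Nat.exists_eq_add_of_le hjm
      rw [Nat.add_comm m i, Function.iterate_add_apply, Function.iterate_add_apply]
      exact h2' _ (mem_image_of_mem _ hx) _ (mem_image_of_mem _ hy) e1 i (by omega)

/-- Labels may be taken in any finite set. -/
lemma HasLabelling.of_finset {T : X → X} {S : Set X} {ε : ℝ} {n : ℕ} {ι : Type*} (I : Finset ι)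
    (l : X → ι) (h1 : ∀ x ∈ S, l x ∈ I)
    (h2 : ∀ x ∈ S, ∀ y ∈ S, l x = l y → ∀ j < n, dist (T^[j] x) (T^[j] y) < ε) :
    HasLabelling T S ε n I.card := by
  classical
  refine ⟨fun x => if h : l x ∈ I then I.equivFin ⟨l x, h⟩ else 0, ?_, ?_⟩
  · intro x hx
    simp only [h1 x hx, dif_pos]
    exact Fin.is_lt _
  · intro x hx y hy hl
    simp only [h1 x hx, h1 y hy, dif_pos] at hl
    have := I.equivFin.injective (Fin.ext hl)
    exact h2 x hx y hy (congrArg Subtype.val this)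

/-- One representative in `S` of each label used gives a dynamical cover. -/
lemma HasLabelling.coverMincard_le {T : X → X} {S : Set X} {ε : ℝ} {n k : ℕ}
    (h : HasLabelling T S ε n k) :
    Dynamics.coverMincard T S {p : X × X | dist p.1 p.2 < ε} n ≤ k := by
  classical
  obtain ⟨l, h1, h2⟩ := h
  rcases S.eq_empty_or_nonempty with rfl | ⟨x₀, -⟩
  · simp
  have : Nonempty X := ⟨x₀⟩
  choose! r hr using fun (i : ℕ) (hi : ∃ x ∈ S, l x = i) => hi
  have hc : Dynamics.IsDynCoverOf T S {p : X × X | dist p.1 p.2 < ε} n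
      ((Finset.range k).image r : Finset X) := by
    intro x hx
    obtain ⟨hr1, hr2⟩ := hr (l x) ⟨x, hx, rfl⟩
    refine ⟨r (l x), ?_, ?_⟩
    · simp only [Finset.coe_image, Finset.coe_range]
      exact ⟨l x, h1 x hx, rfl⟩
    · rw [Dynamics.mem_dynEntourage]
      intro j hj
      exact h2 _ hx _ hr1 hr2.symm j hj
  refine hc.coverMincard_le_card.trans ?_
  exact_mod_cast Finset.card_image_le.trans (by simp)

/-- Exponential bounds on the number of labels bound the entropy. -/
lemma coverEntropy_le_of_hasLabelling {T : X → X} {K : Set X} {a : ℝ}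
    (h : ∀ ε > 0, ∀ b > a, ∃ D : ℝ, ∀ n : ℕ, ∃ k : ℕ, (k : ℝ) ≤ D * Real.exp (b * n) ∧
      HasLabelling T K ε n k) : Dynamics.coverEntropy T K ≤ (a : EReal) := by
  rw [Dynamics.coverEntropy_eq_iSup_basis Metric.uniformity_basis_dist]
  refine iSup₂_le fun ε hε => EReal.le_of_forall_lt_iff_le.1 fun b hb => ?_
  obtain ⟨D, hD⟩ := h ε hε b (by exact_mod_cast hb)
  rw [Dynamics.coverEntropyEntourage]
  have := ExpGrowth.expGrowthSup_le_of_eventually_le (b := ENNReal.ofReal D)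
    (u := fun n : ℕ => ((Dynamics.coverMincard T K {p : X × X | dist p.1 p.2 < ε} n : ℕ∞) : ENNReal))
    (v := fun n : ℕ => EReal.exp ((b : EReal) * n)) ENNReal.ofReal_ne_top
    (Eventually.of_forall fun n => ?_)
  · rwa [ExpGrowth.expGrowthSup_exp] at this
  · obtain ⟨k, hk, hl⟩ := hD n
    have h1 := hl.coverMincard_le
    have h2 : EReal.exp ((b : EReal) * n) = ENNReal.ofReal (Real.exp (b * n)) := by
      rw [← EReal.exp_coe]; push_cast; rfl
    have hD0 : 0 ≤ D := by
      by_contra hneg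
      have : D * Real.exp (b * n) < 0 := mul_neg_of_neg_of_pos (not_le.1 hneg) (Real.exp_pos _)
      exact absurd (hk.trans_lt this) (not_lt.2 (Nat.cast_nonneg k))
    rw [h2, ← ENNReal.ofReal_mul hD0]
    calc ((Dynamics.coverMincard T K {p : X × X | dist p.1 p.2 < ε} n : ℕ∞) : ENNReal)
        ≤ ((k : ℕ∞) : ENNReal) := by exact_mod_cast h1
      _ = ENNReal.ofReal (k : ℝ) := by simp
      _ ≤ _ := ENNReal.ofReal_le_ofReal hk

/-! ### Comparing the entropy of a compact set with that of a set absorbing it -/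

/-- An open neighbourhood of `A` is labelled as economically as `A` is covered. -/
lemma exists_isOpen_hasLabelling {T : X → X} (hT : Continuous T) {A : Set X} {a b : ℝ}
    (ha : Dynamics.coverEntropy T A ≤ (a : EReal)) (hab : a < b) {ε : ℝ} (hε : 0 < ε) :
    ∀ᶠ m : ℕ in atTop, ∃ N : Set X, IsOpen N ∧ A ⊆ N ∧ ∃ k : ℕ, (k : ℝ) ≤ Real.exp (b * m) ∧
      HasLabelling T N ε m k := by
  classical
  have hlt : Dynamics.coverEntropyEntourage T A {p : X × X | dist p.1 p.2 < ε / 2} < (b : EReal) :=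
    ((Dynamics.coverEntropyEntourage_le_coverEntropy T A
      (Metric.dist_mem_uniformity (half_pos hε))).trans ha).trans_lt (by exact_mod_cast hab)
  filter_upwards [ExpGrowth.eventually_le_exp hlt] with m hm
  have h2 : EReal.exp ((b : EReal) * m) = ENNReal.ofReal (Real.exp (b * m)) := by
    rw [← EReal.exp_coe]; push_cast; rfl
  rw [h2] at hm
  have hfin : Dynamics.coverMincard T A {p : X × X | dist p.1 p.2 < ε / 2} m < ⊤ := by
    rw [← ENat.toENNReal_lt_top]
    exact hm.trans_lt ENNReal.ofReal_lt_top
  obtain ⟨s, hs, hcard⟩ := (Dynamics.coverMincard_finite_iff _ _ _ _).1 hfin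
  refine ⟨⋃ y ∈ s, ⋂ j ∈ Finset.range m, {x | dist (T^[j] x) (T^[j] y) < ε / 2}, ?_, ?_, s.card,
    ?_, ?_⟩
  · refine isOpen_biUnion fun y _ => isOpen_biInter_finset fun j _ => ?_
    exact isOpen_lt ((hT.iterate j).dist continuous_const) continuous_const
  · intro x hx
    obtain ⟨y, hy, hxy⟩ := hs hx
    rw [Dynamics.mem_dynEntourage] at hxy
    simp only [mem_iUnion, mem_iInter]
    exact ⟨y, hy, fun j hj => hxy j (Finset.mem_range.1 hj)⟩
  · rw [← hcard] at hm
    have : ((s.card : ℕ∞) : ENNReal) = ENNReal.ofReal (s.card : ℝ) := by simp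
    rw [this] at hm
    exact (ENNReal.ofReal_le_ofReal_iff (Real.exp_pos _).le).1 hm
  · have key : ∀ x, ∃ y, x ∈ (⋃ y ∈ s, ⋂ j ∈ Finset.range m,
        {x | dist (T^[j] x) (T^[j] y) < ε / 2}) →
        y ∈ s ∧ ∀ j < m, dist (T^[j] x) (T^[j] y) < ε / 2 := by
      intro x
      by_cases hx : x ∈ (⋃ y ∈ s, ⋂ j ∈ Finset.range m,
        {x | dist (T^[j] x) (T^[j] y) < ε / 2})
      · obtain ⟨y, hy, hxy⟩ := mem_iUnion₂.1 hx
        simp only [mem_iInter] at hxy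
        exact ⟨y, fun _ => ⟨hy, fun j hj => hxy j (Finset.mem_range.2 hj)⟩⟩
      · exact ⟨x, fun h => absurd h hx⟩
    choose l hl using key
    refine HasLabelling.of_finset s l (fun x hx => (hl x hx).1) fun x hx y hy hxy j hj => ?_
    have e1 := (hl x hx).2 j hj
    have e2 := (hl y hy).2 j hj
    rw [← hxy] at e2
    calc _ ≤ _ := dist_triangle_right _ _ (T^[j] (l x))
      _ < ε := by linarith

/-- If every orbit in the compact set `K` is eventually in the open set `N`, the time spent
outside `N` is uniformly sublinear. -/
lemma exists_hits_le {T : X → X} (hT : Continuous T) {K N : Set X} (hK : IsCompact K)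
    (hKK : MapsTo T K K) (hN : IsOpen N) (hKN : ∀ x ∈ K, ∃ n, ∀ k ≥ n, T^[k] x ∈ N) {δ : ℝ}
    (hδ : 0 < δ) : ∃ D : ℕ, ∀ x ∈ K, ∀ n, (hits T (· ∉ N) x n : ℝ) ≤ δ * n + D := by
  classical
  have hloc : ∀ x ∈ K, ∃ n : ℕ, 0 < n ∧ ∀ᶠ y in 𝓝 x, (hits T (· ∉ N) y n : ℝ) ≤ δ * n := by
    intro x hx
    obtain ⟨n₀, hn₀⟩ := hKN x hx
    obtain ⟨n, hn⟩ := exists_nat_ge ((n₀ : ℝ) / δ)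
    -- At most `n₀` visits outside `N` occur, and n ≥ n₀/δ makes this at most δ times the block
    -- length; the 1 keeps the length positive.
    refine ⟨n + n₀ + 1, by omega, ?_⟩
    have h1 : hits T (· ∉ N) x (n + n₀ + 1) ≤ n₀ := by
      rw [show n + n₀ + 1 = n₀ + (n + 1) by omega, hits_add]
      have : hits T (· ∉ N) (T^[n₀] x) (n + 1) = 0 := by
        refine Finset.sum_eq_zero fun k _ => ?_
        rw [← Function.iterate_add_apply]
        simp [hn₀ (k + n₀) (by omega)]
      rw [this, Nat.add_zero]
      exact hits_le _ _ _ _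
    have h2 : ∀ᶠ y in 𝓝 x, ∀ k ∈ Finset.range (n + n₀ + 1), T^[k] x ∈ N → T^[k] y ∈ N := by
      rw [Filter.eventually_all_finset]
      intro k _
      by_cases hk : T^[k] x ∈ N
      · filter_upwards [(hT.iterate k).continuousAt.eventually (hN.mem_nhds hk)] with y hy _
        exact hy
      · exact Eventually.of_forall fun y h => absurd h hk
    filter_upwards [h2] with y hy
    have h3 : hits T (· ∉ N) y (n + n₀ + 1) ≤ hits T (· ∉ N) x (n + n₀ + 1) := by
      refine Finset.sum_le_sum fun k hk => ?_
      by_cases hx : T^[k] x ∈ N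
      · simp [hx, hy k hk hx]
      · simp only [hx, not_false_eq_true, if_true]
        split_ifs <;> simp
    have h4 : (hits T (· ∉ N) y (n + n₀ + 1) : ℝ) ≤ n₀ := by exact_mod_cast h3.trans h1
    rw [div_le_iff₀ hδ] at hn
    push_cast
    have : 0 ≤ δ * (n₀ + 1) := by positivity
    nlinarith
  choose! ν hν0 hν using hloc
  obtain ⟨t, htK, ht⟩ := hK.elim_nhds_subcover (fun x => {y | (hits T (· ∉ N) y (ν x) : ℝ) ≤ δ * ν x})
    fun x hx => hν x hx
  -- The orbit is cut into blocks of lengths `ν z`. Full blocks obey the bound δ, and the sum of all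
  -- lengths pays for the last incomplete one.
  refine ⟨∑ x ∈ t, ν x, fun x hx n => ?_⟩
  induction n using Nat.strong_induction_on generalizing x with
  | _ n ih =>
    obtain ⟨z, hz, hxz⟩ := mem_iUnion₂.1 (ht hx)
    have hzD : ν z ≤ ∑ x ∈ t, ν x := Finset.single_le_sum (fun _ _ => Nat.zero_le _) hz
    have hz0 := hν0 z (htK z hz)
    rcases le_or_gt n (ν z) with hn | hn
    · have h1 : hits T (· ∉ N) x n ≤ ∑ x ∈ t, ν x := (hits_le _ _ _ _).trans (hn.trans hzD)
      have h2 : (hits T (· ∉ N) x n : ℝ) ≤ ((∑ x ∈ t, ν x : ℕ) : ℝ) := by exact_mod_cast h1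
      have : 0 ≤ δ * n := by positivity
      linarith
    · obtain ⟨k, rfl⟩ := Nat.exists_eq_add_of_lt hn
      have h1 := ih (k + 1) (by omega) (T^[ν z] x) (hKK.iterate _ hx)
      rw [add_assoc, hits_add]
      simp only [mem_ofPred_eq] at hxz
      push_cast at h1 ⊢
      linarith

/-- The number of labels needed for points that spend at most `r` steps outside `N`. -/
lemma exists_hasLabelling_of_hits_le {T : X → X} {K N : Set X} {ε lam B : ℝ} {m M C : ℕ}
    (hKK : MapsTo T K K) (hm : 0 < m) (hN : HasLabelling T N ε m M) (hC : HasLabelling T K ε 1 C)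
    (hlam : 1 ≤ lam) (hB : 1 ≤ B) (hM : (M : ℝ) * 2 ≤ lam ^ m) (hCB : (C : ℝ) * 2 ≤ lam * B) (n : ℕ) :
    ∀ (r : ℕ) (S : Set X), S ⊆ K → (∀ x ∈ S, hits T (· ∉ N) x n ≤ r) →
      ∃ k : ℕ, (k : ℝ) ≤ (2 * M + 1) * (lam ^ n * B ^ r) ∧ HasLabelling T S ε n k := by
  classical
  induction n using Nat.strong_induction_on with
  | _ n ih =>
  intro r S hSK hS
  have hpos : ∀ n r : ℕ, 1 ≤ lam ^ n * B ^ r := fun n r =>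
    one_le_mul_of_one_le_of_one_le (one_le_pow₀ hlam) (one_le_pow₀ hB)
  have hM0 : (0 : ℝ) ≤ M := Nat.cast_nonneg M
  have hC0 : (0 : ℝ) ≤ C := Nat.cast_nonneg C
  rcases Nat.eq_zero_or_pos n with rfl | hn
  · refine ⟨1, ?_, fun _ => 0, by simp, by simp⟩
    have := hpos 0 r
    push_cast
    nlinarith
  -- A start in `N` spends m steps at the price of `M` labels; a start outside spends one step, `C`
  -- labels and one unit of r. Each case may use half the bound, which is why factors 2 appear in
  -- the hypotheses.
  have hin : ∃ k : ℕ, (k : ℝ) * 2 ≤ (2 * M + 1) * (lam ^ n * B ^ r) ∧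
      HasLabelling T (S ∩ N) ε n k := by
    rcases le_or_gt n m with hnm | hnm
    · refine ⟨M, ?_, hN.mono inter_subset_right hnm⟩
      have := hpos n r
      nlinarith
    · obtain ⟨j, rfl⟩ := Nat.exists_eq_add_of_lt hnm
      rw [add_assoc]
      obtain ⟨k, hk, hkl⟩ := ih (j + 1) (by omega) r (T^[m] '' (S ∩ N))
        (by rintro _ ⟨x, hx, rfl⟩; exact hKK.iterate m (hSK hx.1))
        (by
          rintro _ ⟨x, hx, rfl⟩
          have := hS x hx.1
          rw [add_assoc, hits_add] at this
          omega)
      refine ⟨M * k, ?_, (hN.mono inter_subset_right le_rfl).concat hkl⟩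
      have h1 : (0 : ℝ) ≤ (2 * M + 1) * (lam ^ (j + 1) * B ^ r) := by positivity
      rw [pow_add]
      push_cast
      calc (M : ℝ) * k * 2 = (M * 2) * k := by ring
        _ ≤ lam ^ m * ((2 * M + 1) * (lam ^ (j + 1) * B ^ r)) :=
          mul_le_mul hM hk (Nat.cast_nonneg k) (by positivity)
        _ = _ := by ring
  have hout : ∃ k : ℕ, (k : ℝ) * 2 ≤ (2 * M + 1) * (lam ^ n * B ^ r) ∧
      HasLabelling T (S \ N) ε n k := by
    obtain ⟨j, rfl⟩ := Nat.exists_eq_add_of_lt hn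
    rw [zero_add] at hS ⊢
    rcases Nat.eq_zero_or_pos r with rfl | hr
    · have : S \ N = ∅ := by
        refine eq_empty_of_forall_notMem fun x hx => ?_
        have := hS x hx.1
        rw [hits_succ] at this
        simp [hx.2] at this
      refine ⟨0, by simp only [CharP.cast_eq_zero, zero_mul]; positivity, fun _ => 0, ?_, ?_⟩ <;>
        simp [this]
    · obtain ⟨i, rfl⟩ := Nat.exists_eq_add_of_lt hr
      rw [zero_add] at hS ⊢
      obtain ⟨k, hk, hkl⟩ := ih j (by omega) i (T^[1] '' (S \ N))
        (by rintro _ ⟨x, hx, rfl⟩; exact hKK.iterate 1 (hSK hx.1))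
        (by
          rintro _ ⟨x, hx, rfl⟩
          have := hS x hx.1
          rw [hits_succ] at this
          simp only [hx.2, not_false_eq_true, if_true] at this
          simp only [Function.iterate_one]
          omega)
      refine ⟨C * k, ?_, ?_⟩
      · push_cast
        calc (C : ℝ) * k * 2 = (C * 2) * k := by ring
          _ ≤ (lam * B) * ((2 * M + 1) * (lam ^ j * B ^ i)) :=
            mul_le_mul hCB hk (Nat.cast_nonneg k) (by positivity)
          _ = _ := by ring
      · rw [Nat.add_comm j 1]
        exact (hC.mono (sdiff_subset.trans hSK) le_rfl).concat hkl
  obtain ⟨k, hk, hkl⟩ := hin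
  obtain ⟨k', hk', hkl'⟩ := hout
  refine ⟨k + k', by push_cast; linarith, ?_⟩
  have := hkl.union hkl'
  rwa [inter_union_sdiff] at this

lemma exists_hasLabelling_one_of_isCompact {K : Set X} (hK : IsCompact K) (T : X → X) {ε : ℝ}
    (hε : 0 < ε) : ∃ C : ℕ, HasLabelling T K ε 1 C := by
  classical
  obtain ⟨t, -, ht⟩ := hK.elim_nhds_subcover (fun x => Metric.ball x (ε / 2))
    fun x _ => Metric.ball_mem_nhds x (half_pos hε)
  have key : ∀ x, ∃ y, x ∈ K → y ∈ t ∧ dist x y < ε / 2 := by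
    intro x
    by_cases hx : x ∈ K
    · obtain ⟨y, hy, hxy⟩ := mem_iUnion₂.1 (ht hx)
      exact ⟨y, fun _ => ⟨hy, hxy⟩⟩
    · exact ⟨x, fun h => absurd h hx⟩
  choose l hl using key
  refine ⟨t.card, HasLabelling.of_finset t l (fun x hx => (hl x hx).1) fun x hx y hy hxy j hj => ?_⟩
  obtain rfl : j = 0 := by omega
  have e1 := (hl x hx).2
  have e2 := (hl y hy).2
  rw [← hxy] at e2
  calc _ ≤ _ := dist_triangle_right _ _ (l x)
    _ < ε := by simp only [Function.iterate_zero, id]; linarith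

/-- If every orbit of the compact invariant set `K` enters the invariant set `A`, then `K` carries
no more entropy than `A`. -/
theorem coverEntropy_le_of_forall_exists_iterate_mem {T : X → X} (hT : Continuous T) {K A : Set X}
    (hK : IsCompact K) (hKK : MapsTo T K K) (hAA : MapsTo T A A)
    (hKA : ∀ x ∈ K, ∃ n, T^[n] x ∈ A) :
    Dynamics.coverEntropy T K ≤ Dynamics.coverEntropy T A := by
  rcases K.eq_empty_or_nonempty with rfl | ⟨x₀, hx₀⟩
  · simp
  obtain ⟨n₀, hn₀⟩ := hKA x₀ hx₀
  have hA0 : 0 ≤ Dynamics.coverEntropy T A := Dynamics.coverEntropy_nonneg T ⟨_, hn₀⟩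
  refine EReal.le_of_forall_lt_iff_le.1 fun a ha => ?_
  have ha0 : 0 ≤ a := by exact_mod_cast hA0.trans ha.le
  refine coverEntropy_le_of_hasLabelling fun ε hε b hb => ?_
  -- The gap from `b₁` to `b₂` absorbs the factor 2 per block, for m large; the gap from `b₂` to b
  -- absorbs the steps spent outside `N`.
  obtain ⟨b₁, hab₁, hb₁b⟩ := exists_between hb
  obtain ⟨b₂, hb₁₂, hb₂b⟩ := exists_between hb₁b
  obtain ⟨m, ⟨N, hNo, hAN, M, hM, hMl⟩, hm0, hm2⟩ :=
    ((exists_isOpen_hasLabelling hT ha.le hab₁ hε).and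
      ((eventually_gt_atTop 0).and
        ((tendsto_natCast_atTop_atTop.const_mul_atTop (sub_pos.2 hb₁₂)).eventually_ge_atTop
          (Real.log 2)))).exists
  obtain ⟨C, hC⟩ := exists_hasLabelling_one_of_isCompact hK T hε
  have hb₂0 : 0 < b₂ := by linarith
  have hlam : 1 ≤ Real.exp b₂ := Real.one_le_exp hb₂0.le
  set B : ℝ := 2 * C + 1 with hB
  have hB1 : 1 ≤ B := by
    have : (0 : ℝ) ≤ C := Nat.cast_nonneg C
    linarith
  have hM2 : (M : ℝ) * 2 ≤ Real.exp b₂ ^ m := by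
    have h2 : (2 : ℝ) ≤ Real.exp ((b₂ - b₁) * m) := by
      rw [← Real.log_le_iff_le_exp (by norm_num)]; exact hm2
    calc (M : ℝ) * 2 ≤ Real.exp (b₁ * m) * Real.exp ((b₂ - b₁) * m) :=
          mul_le_mul hM h2 (by norm_num) (Real.exp_pos _).le
      _ = Real.exp b₂ ^ m := by
          rw [← Real.exp_add, ← Real.exp_nat_mul]; ring_nf
  have hCB : (C : ℝ) * 2 ≤ Real.exp b₂ * B := by
    have : (0 : ℝ) ≤ C := Nat.cast_nonneg C
    nlinarith
  have hlogB : 0 ≤ Real.log B := Real.log_nonneg hB1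
  -- The added 1 keeps the denominator positive when log B = 0.
  set δ : ℝ := (b - b₂) / (Real.log B + 1) with hδ
  have hδ0 : 0 < δ := div_pos (by linarith) (by linarith)
  have hδB : δ * Real.log B ≤ b - b₂ := by
    have : δ * (Real.log B + 1) = b - b₂ := div_mul_cancel₀ _ (by linarith)
    linarith
  obtain ⟨D, hD⟩ := exists_hits_le hT hK hKK hNo (fun x hx => by
    obtain ⟨n, hn⟩ := hKA x hx
    refine ⟨n, fun k hk => hAN ?_⟩
    obtain ⟨j, rfl⟩ := Nat.exists_eq_add_of_le' hk
    rw [Function.iterate_add_apply]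
    exact hAA.iterate j hn) hδ0
  refine ⟨(2 * M + 1) * Real.exp (Real.log B * D), fun n => ?_⟩
  obtain ⟨k, hk, hkl⟩ := exists_hasLabelling_of_hits_le hKK hm0 hMl hC hlam hB1 hM2 hCB n
    ⌊δ * n + D⌋₊ K subset_rfl (fun x hx => Nat.le_floor (hD x hx n))
  refine ⟨k, hk.trans ?_, hkl⟩
  rw [mul_assoc]
  refine mul_le_mul_of_nonneg_left ?_ (by positivity)
  have hfl : ((⌊δ * n + D⌋₊ : ℕ) : ℝ) ≤ δ * n + D := Nat.floor_le (by positivity)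
  have hBr : B ^ ⌊δ * n + D⌋₊ ≤ Real.exp (Real.log B * (δ * n + D)) := by
    rw [← Real.rpow_natCast, Real.rpow_def_of_pos (by linarith)]
    exact Real.exp_le_exp.2 (mul_le_mul_of_nonneg_left hfl hlogB)
  calc Real.exp b₂ ^ n * B ^ ⌊δ * n + D⌋₊
      ≤ Real.exp (b₂ * n) * Real.exp (Real.log B * (δ * n + D)) := by
        rw [← Real.exp_nat_mul, mul_comm (n : ℝ) b₂]
        exact mul_le_mul_of_nonneg_left hBr (Real.exp_pos _).le
    _ = Real.exp (b₂ * n + δ * Real.log B * n + Real.log B * D) := by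
        rw [← Real.exp_add]; ring_nf
    _ ≤ Real.exp (Real.log B * D + b * n) := by
        refine Real.exp_le_exp.2 ?_
        have : δ * Real.log B * n ≤ (b - b₂) * n :=
          mul_le_mul_of_nonneg_right hδB (Nat.cast_nonneg n)
        linarith
    _ = _ := Real.exp_add _ _

lemma coverEntropy_le_zero_of_finite {A : Set X} (hA : A.Finite) (T : X → X) :
    Dynamics.coverEntropy T A ≤ 0 := by
  refine coverEntropy_le_of_hasLabelling (a := 0) fun ε hε b hb =>
    ⟨hA.toFinset.card, fun n => ⟨hA.toFinset.card, ?_, ?_⟩⟩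
  · exact le_mul_of_one_le_right (Nat.cast_nonneg _) (Real.one_le_exp (by positivity))
  · exact HasLabelling.of_finset hA.toFinset id (fun x hx => by simpa using hx)
      fun x _ y _ h j _ => by simpa [show x = y from h] using hε

end Entropy

/-! ### Entropy on a graph and the number of itineraries -/

section Itineraries

/-- The half-open quadrant of the plane containing `p`. -/
noncomputable def quadrant (p : ℝ × ℝ) : Bool × Bool := (decide (0 ≤ p.1), decide (0 ≤ p.2))

/-- The sign of a coordinate in a quadrant. -/
def boolSign (s : Bool) : ℝ := if s then 1 else -1

lemma abs_eq_boolSign_mul (x : ℝ) : |x| = boolSign (decide (0 ≤ x)) * x := by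
  by_cases h : 0 ≤ x
  · simp [boolSign, h, abs_of_nonneg h]
  · simp [boolSign, h, abs_of_neg (not_le.1 h)]

/-- The image of a vector `v` under the linear part of the `n`-th iterate of the map, for points
with itinerary `w`. -/
def itineraryDeriv (w : ℕ → Bool × Bool) (v : ℝ × ℝ) : ℕ → ℝ × ℝ
  | 0 => v
  | n + 1 =>
    (boolSign (w n).1 * (itineraryDeriv w v n).1 - (itineraryDeriv w v n).2,
      (itineraryDeriv w v n).1 - boolSign (w n).2 * (itineraryDeriv w v n).2)

lemma itineraryDeriv_congr {w w' : ℕ → Bool × Bool} (v : ℝ × ℝ) {n : ℕ}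
    (h : ∀ k < n, w k = w' k) : itineraryDeriv w v n = itineraryDeriv w' v n := by
  induction n with
  | zero => rfl
  | succ n ih =>
    simp only [itineraryDeriv, ih fun k hk => h k (by omega), h n (by omega)]

/-- The itinerary of a point. -/
noncomputable def itinerary (a b : ℝ) (x : ℝ × ℝ) (k : ℕ) : Bool × Bool :=
  quadrant ((planeMap a b)^[k] x)

/-- A common itinerary means that the same affine maps act on both points, so only their linear
parts act on the difference. -/
lemma iterate_sub_iterate (a b : ℝ) {x y v : ℝ × ℝ} {s : ℝ} (hxy : x - y = s • v) {n : ℕ}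
    (h : ∀ k < n, itinerary a b x k = itinerary a b y k) :
    (planeMap a b)^[n] x - (planeMap a b)^[n] y = s • itineraryDeriv (itinerary a b x) v n := by
  induction n with
  | zero => simpa [itineraryDeriv] using hxy
  | succ n ih =>
    have ih := ih fun k hk => h k (by omega)
    have hn := h n (by omega)
    rw [Function.iterate_succ_apply', Function.iterate_succ_apply', itineraryDeriv]
    set p := (planeMap a b)^[n] x with hp
    set q := (planeMap a b)^[n] y with hq
    set d := itineraryDeriv (itinerary a b x) v n
    have e : itinerary a b x n = quadrant p := rfl
    have e' : quadrant p = quadrant q := hn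
    have e1 : decide (0 ≤ p.1) = decide (0 ≤ q.1) := congrArg Prod.fst e'
    have e2 : decide (0 ≤ p.2) = decide (0 ≤ q.2) := congrArg Prod.snd e'
    have i1 : p.1 - q.1 = s * d.1 := congrArg Prod.fst ih
    have i2 : p.2 - q.2 = s * d.2 := congrArg Prod.snd ih
    ext
    · simp only [planeMap, Prod.fst_sub, Prod.smul_fst, smul_eq_mul, e, quadrant]
      rw [abs_eq_boolSign_mul p.1, abs_eq_boolSign_mul q.1, ← e1]
      linear_combination boolSign (decide (0 ≤ p.1)) * i1 - i2
    · simp only [planeMap, Prod.snd_sub, Prod.smul_snd, smul_eq_mul, e, quadrant]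
      rw [abs_eq_boolSign_mul p.2, abs_eq_boolSign_mul q.2, ← e2]
      linear_combination i1 - boolSign (decide (0 ≤ p.2)) * i2

/-- `⌊x / ε⌋`, with the sign changed when `d < 0`. -/
noncomputable def signedFloor (ε d x : ℝ) : ℤ := if 0 ≤ d then ⌊x / ε⌋ else -⌊x / ε⌋

/-- The sign change compensates for a coordinate that decreases along the segment, so that all
signed floors move in the same direction. -/
lemma signedFloor_le {ε d x y s : ℝ} (hε : 0 < ε) (hs : 0 ≤ s) (h : y - x = s * d) :
    signedFloor ε d x ≤ signedFloor ε d y := by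
  unfold signedFloor
  split_ifs with hd
  · have : 0 ≤ s * d := mul_nonneg hs hd
    exact Int.floor_le_floor (by gcongr; linarith)
  · have : s * d ≤ 0 := mul_nonpos_of_nonneg_of_nonpos hs (not_le.1 hd).le
    exact neg_le_neg (Int.floor_le_floor (by gcongr; linarith))

lemma abs_sub_lt_of_signedFloor_eq {ε d x y : ℝ} (hε : 0 < ε)
    (h : signedFloor ε d x = signedFloor ε d y) : |x - y| < ε := by
  have h' : ⌊x / ε⌋ = ⌊y / ε⌋ := by
    unfold signedFloor at h
    split_ifs at h
    · exact h
    · exact neg_injective h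
  have := Int.abs_sub_lt_one_of_floor_eq_floor h'
  rwa [← sub_div, abs_div, abs_of_pos hε, div_lt_one hε] at this

lemma abs_signedFloor_le {ε d x R : ℝ} {Q : ℕ} (hε : 0 < ε) (hx : |x| ≤ R) (hQ : R / ε + 1 ≤ Q) :
    |signedFloor ε d x| ≤ Q := by
  have h1 : |signedFloor ε d x| = |⌊x / ε⌋| := by
    unfold signedFloor; split_ifs <;> simp
  rw [h1, abs_le]
  obtain ⟨hl, hu⟩ := abs_le.1 hx
  have hl' : -(R / ε) ≤ x / ε := by rw [← neg_div]; gcongr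
  have hu' : x / ε ≤ R / ε := by gcongr
  constructor
  · rw [Int.le_floor]; push_cast; linarith
  · have := Int.floor_le (x / ε)
    have h2 : ((⌊x / ε⌋ : ℤ) : ℝ) ≤ ((Q : ℤ) : ℝ) := by push_cast; linarith
    exact_mod_cast h2

/-- A monotone integer invariant of the points of a segment with direction `v` sharing an
itinerary of length `n`. -/
noncomputable def floorSum (a b ε : ℝ) (n : ℕ) (v x : ℝ × ℝ) : ℤ :=
  ∑ k ∈ Finset.range n,
    (signedFloor ε (itineraryDeriv (itinerary a b x) v k).1 ((planeMap a b)^[k] x).1 +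
      signedFloor ε (itineraryDeriv (itinerary a b x) v k).2 ((planeMap a b)^[k] x).2)

/-- Every summand is nondecreasing from x to y, so equal sums force equal summands: at each time
both coordinates lie in the same cell of length ε. One integer thus replaces a list of 2n cells. -/
lemma dist_lt_of_floorSum_eq {a b ε : ℝ} (hε : 0 < ε) {n : ℕ} {v x y : ℝ × ℝ} {s : ℝ} (hs : 0 ≤ s)
    (hxy : y - x = s • v) (hw : ∀ k < n, itinerary a b x k = itinerary a b y k)
    (h : floorSum a b ε n v x = floorSum a b ε n v y) {j : ℕ} (hj : j < n) :
    dist ((planeMap a b)^[j] x) ((planeMap a b)^[j] y) < ε := by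
  have hd : ∀ k < n, itineraryDeriv (itinerary a b y) v k = itineraryDeriv (itinerary a b x) v k :=
    fun k hk => itineraryDeriv_congr v fun i hi => (hw i (hi.trans hk)).symm
  have hsub : ∀ k < n, (planeMap a b)^[k] y - (planeMap a b)^[k] x =
      s • itineraryDeriv (itinerary a b x) v k := fun k hk => by
    rw [← hd k hk]
    exact iterate_sub_iterate a b hxy fun i hi => (hw i (hi.trans hk)).symm
  have h1 : ∀ k < n,
      signedFloor ε (itineraryDeriv (itinerary a b x) v k).1 ((planeMap a b)^[k] x).1 ≤
      signedFloor ε (itineraryDeriv (itinerary a b x) v k).1 ((planeMap a b)^[k] y).1 :=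
    fun k hk => signedFloor_le hε hs (congrArg Prod.fst (hsub k hk))
  have h2 : ∀ k < n,
      signedFloor ε (itineraryDeriv (itinerary a b x) v k).2 ((planeMap a b)^[k] x).2 ≤
      signedFloor ε (itineraryDeriv (itinerary a b x) v k).2 ((planeMap a b)^[k] y).2 :=
    fun k hk => signedFloor_le hε hs (congrArg Prod.snd (hsub k hk))
  have h' : floorSum a b ε n v y = ∑ k ∈ Finset.range n,
    (signedFloor ε (itineraryDeriv (itinerary a b x) v k).1 ((planeMap a b)^[k] y).1 +
      signedFloor ε (itineraryDeriv (itinerary a b x) v k).2 ((planeMap a b)^[k] y).2) :=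
    Finset.sum_congr rfl fun k hk => by rw [hd k (Finset.mem_range.1 hk)]
  rw [h', floorSum, Finset.sum_eq_sum_iff_of_le fun k hk =>
    add_le_add (h1 k (Finset.mem_range.1 hk)) (h2 k (Finset.mem_range.1 hk))] at h
  have hj' := h j (Finset.mem_range.2 hj)
  have e1 := h1 j hj
  have e2 := h2 j hj
  rw [Prod.dist_eq, max_lt_iff, Real.dist_eq, Real.dist_eq]
  exact ⟨abs_sub_lt_of_signedFloor_eq (d := (itineraryDeriv (itinerary a b x) v j).1) hε (by omega),
    abs_sub_lt_of_signedFloor_eq (d := (itineraryDeriv (itinerary a b x) v j).2) hε (by omega)⟩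

lemma abs_floorSum_le {a b ε R : ℝ} {Q : ℕ} (hε : 0 < ε) (hQ : R / ε + 1 ≤ Q) {n : ℕ}
    {v x : ℝ × ℝ} (hx : ∀ k, ‖(planeMap a b)^[k] x‖ ≤ R) :
    |floorSum a b ε n v x| ≤ (2 * n * Q : ℕ) := by
  refine (Finset.abs_sum_le_sum_abs _ _).trans ?_
  refine (Finset.sum_le_card_nsmul _ _ (2 * Q : ℤ) fun k _ => ?_).trans ?_
  · refine (abs_add_le _ _).trans ?_
    have e1 := abs_signedFloor_le (d := (itineraryDeriv (itinerary a b x) v k).1) hε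
      ((norm_fst_le _).trans (hx k)) hQ
    have e2 := abs_signedFloor_le (d := (itineraryDeriv (itinerary a b x) v k).2) hε
      ((norm_snd_le _).trans (hx k)) hQ
    linarith
  · rw [Finset.card_range, nsmul_eq_mul]
    push_cast
    exact le_of_eq (by ring)

/-- The points of an invariant graph are labelled by edges, itineraries and linearly many
integers. -/
lemma hasLabelling_of_itineraries {a b R ε : ℝ} {Γ : Set (ℝ × ℝ)} {n Q : ℕ}
    {S : Finset ((ℝ × ℝ) × (ℝ × ℝ))} (hS : Γ = ⋃ s ∈ S, segment ℝ s.1 s.2)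
    (hΓ : MapsTo (planeMap a b) Γ Γ) (hR : ∀ x ∈ Γ, ‖x‖ ≤ R) (hε : 0 < ε) (hQ : R / ε + 1 ≤ Q)
    (W : Finset (Fin n → Bool × Bool)) (hW : ∀ x ∈ Γ, (fun i : Fin n => itinerary a b x i) ∈ W) :
    HasLabelling (planeMap a b) Γ ε n (S.card * (W.card * (4 * n * Q + 1))) := by
  classical
  have hedge : ∀ x : ℝ × ℝ, ∃ s : (ℝ × ℝ) × (ℝ × ℝ), x ∈ Γ → s ∈ S ∧
      ∃ t : ℝ, x = s.1 + t • (s.2 - s.1) := by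
    intro x
    by_cases hx : x ∈ Γ
    · rw [hS] at hx
      obtain ⟨s, hs, hxs⟩ := mem_iUnion₂.1 hx
      rw [segment_eq_image'] at hxs
      obtain ⟨t, -, ht⟩ := hxs
      exact ⟨s, fun _ => ⟨hs, t, ht.symm⟩⟩
    · exact ⟨0, fun h => absurd h hx⟩
  choose e he using hedge
  have hcard : (S ×ˢ (W ×ˢ Finset.Icc (-(2 * n * Q : ℕ) : ℤ) (2 * n * Q : ℕ))).card =
      S.card * (W.card * (4 * n * Q + 1)) := by
    rw [Finset.card_product, Finset.card_product, Int.card_Icc]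
    congr 2
    push_cast
    rw [show (2 * n * Q + 1 - -(2 * n * Q) : ℤ) = ((4 * n * Q + 1 : ℕ) : ℤ) by push_cast; ring]
    exact Int.toNat_natCast _
  rw [← hcard]
  refine HasLabelling.of_finset _ (fun x => (e x, (fun i : Fin n => itinerary a b x i),
    floorSum a b ε n ((e x).2 - (e x).1) x)) ?_ ?_
  · intro x hx
    simp only [Finset.mem_product, Finset.mem_Icc]
    exact ⟨(he x hx).1, hW x hx, abs_le.1 (abs_floorSum_le hε hQ fun k => hR _ (hΓ.iterate k hx))⟩
  · intro x hx y hy hl j hj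
    simp only [Prod.mk.injEq] at hl
    obtain ⟨h1, h2, h3⟩ := hl
    obtain ⟨-, t, ht⟩ := he x hx
    obtain ⟨-, u, hu⟩ := he y hy
    have hw : ∀ k < n, itinerary a b x k = itinerary a b y k := fun k hk => congrFun h2 ⟨k, hk⟩
    rw [← h1] at hu h3
    rcases le_total t u with htu | htu
    · refine dist_lt_of_floorSum_eq hε (sub_nonneg.2 htu) ?_ hw h3 hj
      calc y - x = _ := congrArg₂ _ hu ht
        _ = _ := by rw [sub_smul, add_sub_add_left_eq_sub]
    · rw [dist_comm]
      refine dist_lt_of_floorSum_eq hε (sub_nonneg.2 htu) ?_ (fun k hk => (hw k hk).symm) h3.symm hj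
      calc x - y = _ := congrArg₂ _ ht hu
        _ = _ := by rw [sub_smul, add_sub_add_left_eq_sub]

lemma IsCompactGraph.isCompact {Γ : Set (ℝ × ℝ)} (h : IsCompactGraph Γ) : IsCompact Γ := by
  obtain ⟨S, rfl⟩ := h
  refine S.isCompact_biUnion fun s _ => ?_
  rw [segment_eq_image]
  exact isCompact_Icc.image (by fun_prop)

/-- The entropy on an invariant graph is at most the growth rate of the number of itineraries. -/
theorem coverEntropy_le_of_itineraries {a b h : ℝ} {Γ : Set (ℝ × ℝ)} (hΓ : IsCompactGraph Γ)
    (hinv : MapsTo (planeMap a b) Γ Γ)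
    (hW : ∃ D : ℝ, ∀ n : ℕ, ∃ W : Finset (Fin n → Bool × Bool), (W.card : ℝ) ≤ D * Real.exp (h * n) ∧
      ∀ x ∈ Γ, (fun i : Fin n => itinerary a b x i) ∈ W) :
    Dynamics.coverEntropy (planeMap a b) Γ ≤ (h : EReal) := by
  obtain ⟨R, hR⟩ := hΓ.isCompact.isBounded.exists_norm_le
  obtain ⟨S, hS⟩ := hΓ
  obtain ⟨D, hD⟩ := hW
  refine coverEntropy_le_of_hasLabelling fun ε hε b' hb => ?_
  obtain ⟨Q, hQ⟩ := exists_nat_ge (R / ε + 1)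
  have hη : 0 < b' - h := sub_pos.2 hb
  -- The linear factor 4nQ + 1 is absorbed by exp((b' - h) n), at the price of this constant.
  refine ⟨S.card * (D * (4 * Q / (b' - h) + 1)), fun n => ?_⟩
  obtain ⟨W, hWD, hWΓ⟩ := hD n
  refine ⟨_, ?_, hasLabelling_of_itineraries hS hinv hR hε hQ W hWΓ⟩
  have h1 : (4 * n * Q + 1 : ℝ) ≤ (4 * Q / (b' - h) + 1) * Real.exp ((b' - h) * n) := by
    have e1 := Real.add_one_le_exp ((b' - h) * n)
    have e2 : (1 : ℝ) ≤ Real.exp ((b' - h) * n) := Real.one_le_exp (by positivity)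
    have e3 : (4 * n * Q : ℝ) = 4 * Q / (b' - h) * ((b' - h) * n) := by field_simp
    rw [e3, add_mul, one_mul]
    refine add_le_add (mul_le_mul_of_nonneg_left (by linarith) (by positivity)) e2
  have h2 : Real.exp (b' * n) = Real.exp (h * n) * Real.exp ((b' - h) * n) := by
    rw [← Real.exp_add]; ring_nf
  push_cast
  rw [h2]
  calc (S.card : ℝ) * (W.card * (4 * n * Q + 1))
      ≤ S.card * ((D * Real.exp (h * n)) *
        ((4 * Q / (b' - h) + 1) * Real.exp ((b' - h) * n))) := by
        refine mul_le_mul_of_nonneg_left ?_ (Nat.cast_nonneg _)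
        exact mul_le_mul hWD h1 (by positivity) ((Nat.cast_nonneg _).trans hWD)
    _ = _ := by ring

/-- All 4 ^ n words are allowed; the bound serves only to make the entropy finite. -/
lemma coverEntropy_le_log_four {a b : ℝ} {Γ : Set (ℝ × ℝ)} (hΓ : IsCompactGraph Γ)
    (hinv : MapsTo (planeMap a b) Γ Γ) :
    Dynamics.coverEntropy (planeMap a b) Γ ≤ (Real.log 4 : EReal) := by
  refine coverEntropy_le_of_itineraries hΓ hinv ⟨1, fun n => ⟨Finset.univ, ?_, by simp⟩⟩
  rw [mul_comm (Real.log 4), Real.exp_nat_mul, Real.exp_log (by norm_num)]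
  simp

/-! ### Counting words that are almost 3-periodic -/

/-- Encoding of a word by its deviations from being 3-periodic. -/
def deviations {n : ℕ} (w : Fin n → Bool × Bool) (i : Fin n) : Option (Bool × Bool) :=
  if 3 ≤ (i : ℕ) ∧ w i = w ⟨i - 3, by omega⟩ then none else some (w i)

/-- The word is recovered from left to right: `none` means to copy the letter three places back. -/
lemma deviations_injective (n : ℕ) : Function.Injective (deviations (n := n)) := by
  intro w w' h
  have key : ∀ (k : ℕ) (hk : k < n), w ⟨k, hk⟩ = w' ⟨k, hk⟩ := by
    intro k
    induction k using Nat.strong_induction_on with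
    | _ k ih =>
      intro hk
      have hi := congrFun h ⟨k, hk⟩
      simp only [deviations] at hi
      split_ifs at hi with h1 h2
      · rw [h1.2, h2.2]
        exact ih (k - 3) (by have := h1.1; omega) _
      · exact Option.some_injective _ hi
  funext i
  exact key i i.2

/-- The number of words with at most `r` deviations. -/
lemma card_deviations_le (n r : ℕ) {z : ℝ} (hz : 0 < z) (hz1 : z ≤ 1) :
    ((Finset.univ.filter fun w : Fin n → Bool × Bool =>
      (∑ i, if deviations w i = none then 0 else 1) ≤ r).card : ℝ) * z ^ r ≤ (1 + 4 * z) ^ n := by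
  classical
  -- Chernoff-type weights: a word with at most r deviations has weight at least z ^ r, and all
  -- codes together weigh (1 + 4z) ^ n.
  let wt : Option (Bool × Bool) → ℝ := fun o => if o = none then 1 else z
  have hwt : ∀ o, 0 ≤ wt o := fun o => by
    simp only [wt]; split_ifs <;> linarith
  have hsum : ∑ o, wt o = 1 + 4 * z := by
    rw [Fintype.sum_option]
    simp [wt]
  calc _ = ∑ w ∈ Finset.univ.filter fun w : Fin n → Bool × Bool =>
        (∑ i, if deviations w i = none then 0 else 1) ≤ r, z ^ r := by
        rw [Finset.sum_const, nsmul_eq_mul]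
    _ ≤ ∑ w ∈ Finset.univ.filter fun w : Fin n → Bool × Bool =>
        (∑ i, if deviations w i = none then 0 else 1) ≤ r, ∏ i, wt (deviations w i) := by
        refine Finset.sum_le_sum fun w hw => ?_
        have hw := (Finset.mem_filter.1 hw).2
        have : ∏ i, wt (deviations w i) = z ^ (∑ i, if deviations w i = none then 0 else 1) := by
          rw [← Finset.prod_pow_eq_pow_sum]
          refine Finset.prod_congr rfl fun i _ => ?_
          simp only [wt]
          split_ifs <;> simp
        rw [this]
        exact pow_le_pow_of_le_one hz.le hz1 hw
    _ ≤ ∑ w : Fin n → Bool × Bool, ∏ i, wt (deviations w i) :=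
        Finset.sum_le_sum_of_subset_of_nonneg (Finset.filter_subset _ _) fun w _ _ =>
          Finset.prod_nonneg fun i _ => hwt _
    _ = ∑ f ∈ Finset.univ.image (deviations (n := n)), ∏ i, wt (f i) :=
        (Finset.sum_image (f := fun f : Fin n → Option (Bool × Bool) => ∏ i, wt (f i))
          fun _ _ _ _ h => deviations_injective n h).symm
    _ ≤ ∑ f : Fin n → Option (Bool × Bool), ∏ i, wt (f i) :=
        Finset.sum_le_sum_of_subset_of_nonneg (Finset.subset_univ _) fun w _ _ =>
          Finset.prod_nonneg fun i _ => hwt _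
    _ = (1 + 4 * z) ^ n := by
        rw [← hsum, Fintype.sum_pow]

/-- The orbit of `p` leaves the 3-periodic pattern of quadrants. -/
def Deviates (a b : ℝ) (p : ℝ × ℝ) : Prop := quadrant ((planeMap a b)^[3] p) ≠ quadrant p

/-- The first three letters always count; a later letter i counts exactly when the orbit deviates at
time i - 3. -/
lemma sum_deviations_le (a b : ℝ) (x : ℝ × ℝ) (n : ℕ) :
    (∑ i, if deviations (fun i : Fin n => itinerary a b x i) i = none then 0 else 1) ≤
      3 + hits (planeMap a b) (Deviates a b) x n := by
  classical
  have h1 : (∑ i, if deviations (fun i : Fin n => itinerary a b x i) i = none then 0 else 1) =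
      ∑ i ∈ Finset.range n,
        if 3 ≤ i ∧ itinerary a b x i = itinerary a b x (i - 3) then 0 else 1 := by
    rw [← Fin.sum_univ_eq_sum_range
      (fun i => if 3 ≤ i ∧ itinerary a b x i = itinerary a b x (i - 3) then 0 else 1)]
    refine Finset.sum_congr rfl fun i _ => ?_
    simp only [deviations]
    split_ifs <;> simp_all
  rw [h1]
  rcases le_or_gt n 3 with hn | hn
  · refine (Finset.sum_le_card_nsmul _ _ 1 fun i _ => ?_).trans ?_
    · split_ifs <;> simp
    · simp; omega
  · obtain ⟨k, rfl⟩ := Nat.exists_eq_add_of_le hn.le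
    rw [Finset.sum_range_add]
    refine add_le_add ?_ ((le_of_eq ?_).trans (hits_mono _ _ _ (Nat.le_add_left k 3)))
    · refine (Finset.sum_le_card_nsmul _ _ 1 fun i _ => ?_).trans (by simp)
      split_ifs <;> simp
    · refine Finset.sum_congr rfl fun i _ => ?_
      have e : Deviates a b ((planeMap a b)^[i] x) ↔
          itinerary a b x (3 + i) ≠ itinerary a b x i := by
        simp only [itinerary, Deviates, Function.iterate_add_apply]
      rw [Nat.add_sub_cancel_left]
      by_cases h : itinerary a b x (3 + i) = itinerary a b x i
      · rw [if_pos ⟨by omega, h⟩, if_neg (by rw [e]; exact not_not.2 h)]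
      · rw [if_neg (fun h' => h h'.2), if_pos (e.2 h)]

/-- If orbits seldom leave the 3-periodic pattern of quadrants, the entropy is small. -/
theorem coverEntropy_le_of_hits_deviates_le {a b δ D z : ℝ} {Γ : Set (ℝ × ℝ)}
    (hΓ : IsCompactGraph Γ) (hinv : MapsTo (planeMap a b) Γ Γ) (hz : 0 < z) (hz1 : z ≤ 1)
    (h : ∀ x ∈ Γ, ∀ n, (hits (planeMap a b) (Deviates a b) x n : ℝ) ≤ δ * n + D) :
    Dynamics.coverEntropy (planeMap a b) Γ ≤
      ((Real.log (1 + 4 * z) + δ * -Real.log z : ℝ) : EReal) := by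
  classical
  rcases Γ.eq_empty_or_nonempty with rfl | ⟨x₀, hx₀⟩
  · simp
  refine coverEntropy_le_of_itineraries hΓ hinv ⟨Real.exp (-Real.log z * (D + 3)), fun n => ?_⟩
  have hlz : Real.log z ≤ 0 := Real.log_nonpos hz.le hz1
  set r := ⌊δ * n + (D + 3)⌋₊
  have h0 : 0 ≤ δ * n + (D + 3) := by
    have := (Nat.cast_nonneg (α := ℝ) _).trans (h x₀ hx₀ n)
    linarith
  refine ⟨Finset.univ.filter fun w : Fin n → Bool × Bool =>
      (∑ i, if deviations w i = none then 0 else 1) ≤ r, ?_, ?_⟩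
  · have h1 := card_deviations_le n r hz hz1
    rw [← le_div_iff₀ (by positivity)] at h1
    refine h1.trans ?_
    have h2 : (z ^ r)⁻¹ ≤ Real.exp (-Real.log z * (δ * n + (D + 3))) := by
      rw [← Real.rpow_natCast, Real.rpow_def_of_pos hz, ← Real.exp_neg]
      refine Real.exp_le_exp.2 ?_
      rw [← neg_mul]
      exact mul_le_mul_of_nonneg_left (Nat.floor_le h0) (by linarith)
    have h3 : (1 + 4 * z) ^ n = Real.exp (Real.log (1 + 4 * z) * n) := by
      rw [mul_comm (Real.log _), Real.exp_nat_mul, Real.exp_log (by linarith)]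
    rw [div_eq_mul_inv, h3]
    refine (mul_le_mul_of_nonneg_left h2 (Real.exp_pos _).le).trans (le_of_eq ?_)
    rw [← Real.exp_add, ← Real.exp_add]
    ring_nf
  · intro x hx
    refine Finset.mem_filter.2 ⟨Finset.mem_univ _, Nat.le_floor ?_⟩
    have h1 : ((∑ i, if deviations (fun i : Fin n => itinerary a b x i) i = none then 0 else 1 : ℕ)
        : ℝ) ≤ ((3 + hits (planeMap a b) (Deviates a b) x n : ℕ) : ℝ) :=
      Nat.cast_le.2 (sum_deviations_le a b x n)
    have := h x hx n
    push_cast at h1 ⊢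
    linarith

end Itineraries

/-! ### The explicit invariant graph for c > 4 -/

section CoreGraph

/-- Closed quadrants suffice because the affine formulas agree on the axes. Only x - y survives
here, so the quadrant collapses onto the line y = x + c + 1. -/
lemma planeMap_quadrant_one {c x y : ℝ} (hx : 0 ≤ x) (hy : 0 ≤ y) :
    planeMap (-1) c (x, y) = (x - y - 1, x - y + c) := by
  simp [planeMap, abs_of_nonneg hx, abs_of_nonneg hy, sub_eq_add_neg]

lemma planeMap_quadrant_two {c x y : ℝ} (hx : x ≤ 0) (hy : 0 ≤ y) :
    planeMap (-1) c (x, y) = (-x - y - 1, x - y + c) := by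
  simp [planeMap, abs_of_nonpos hx, abs_of_nonneg hy, sub_eq_add_neg]

/-- Only x + y survives, so the quadrant collapses onto the line y = -x + c - 1. -/
lemma planeMap_quadrant_three {c x y : ℝ} (hx : x ≤ 0) (hy : y ≤ 0) :
    planeMap (-1) c (x, y) = (-x - y - 1, x + y + c) := by
  simp [planeMap, abs_of_nonpos hx, abs_of_nonpos hy, sub_eq_add_neg]

lemma planeMap_quadrant_four {c x y : ℝ} (hx : 0 ≤ x) (hy : y ≤ 0) :
    planeMap (-1) c (x, y) = (x - y - 1, x + y + c) := by
  simp [planeMap, abs_of_nonneg hx, abs_of_nonpos hy, sub_eq_add_neg]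

/-- The part of the line `y = m x + k` over the interval `[x₀, x₁]`. -/
def lineOver (m k x₀ x₁ : ℝ) : Set (ℝ × ℝ) := {p | p.2 = m * p.1 + k ∧ x₀ ≤ p.1 ∧ p.1 ≤ x₁}

lemma segment_eq_lineOver (m k : ℝ) {x₀ x₁ : ℝ} (h : x₀ ≤ x₁) :
    segment ℝ (x₀, m * x₀ + k) (x₁, m * x₁ + k) = lineOver m k x₀ x₁ := by
  ext ⟨x, y⟩
  rw [segment_eq_image']
  constructor
  · rintro ⟨t, ⟨h0, h1⟩, ht⟩
    simp only [Prod.mk_sub_mk, Prod.smul_mk, Prod.mk_add_mk, smul_eq_mul, Prod.mk.injEq] at ht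
    obtain ⟨rfl, rfl⟩ := ht
    refine ⟨by ring, ?_, ?_⟩ <;> simp only <;> nlinarith
  · rintro ⟨hy, h0, h1⟩
    simp only at hy h0 h1
    rcases h.eq_or_lt with rfl | hlt
    · obtain rfl : x = x₀ := le_antisymm h1 h0
      exact ⟨0, by simp, by simp [hy]⟩
    · have hne : x₁ - x₀ ≠ 0 := (sub_pos.2 hlt).ne'
      refine ⟨(x - x₀) / (x₁ - x₀), ⟨div_nonneg (by linarith) (by linarith),
        (div_le_one (by linarith)).2 (by linarith)⟩, ?_⟩
      have : (x - x₀) / (x₁ - x₀) * (x₁ - x₀) = x - x₀ := div_mul_cancel₀ _ hne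
      ext
      · simp only [Prod.mk_sub_mk, Prod.smul_mk, Prod.mk_add_mk, smul_eq_mul]
        linarith
      · simp only [Prod.mk_sub_mk, Prod.smul_mk, Prod.mk_add_mk, smul_eq_mul]
        rw [hy]
        linear_combination m * this

/-- The explicit invariant graph of `planeMap (-1) c`. -/
def coreGraph (c : ℝ) : Set (ℝ × ℝ) :=
  lineOver 1 (c + 1) (-c - 2) (c - 2) ∪ lineOver 0 (-1) (-c - 2) c ∪
    lineOver (-1) (c - 1) 0 (c + 2) ∪ lineOver 1 (c - 1) 0 c ∪ lineOver 0 (2 * c - 1) (c - 2) (c + 4)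

lemma mem_coreGraph {c x y : ℝ} : (x, y) ∈ coreGraph c ↔
    (y = x + (c + 1) ∧ -c - 2 ≤ x ∧ x ≤ c - 2) ∨ (y = -1 ∧ -c - 2 ≤ x ∧ x ≤ c) ∨
    (y = -x + (c - 1) ∧ 0 ≤ x ∧ x ≤ c + 2) ∨ (y = x + (c - 1) ∧ 0 ≤ x ∧ x ≤ c) ∨
    (y = 2 * c - 1 ∧ c - 2 ≤ x ∧ x ≤ c + 4) := by
  simp only [coreGraph, lineOver, mem_union, mem_ofPred_eq, one_mul, zero_mul, zero_add, neg_one_mul,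
    or_assoc]

lemma isCompactGraph_coreGraph {c : ℝ} (hc : 0 ≤ c) : IsCompactGraph (coreGraph c) := by
  classical
  refine ⟨{((-c - 2, 1 * (-c - 2) + (c + 1)), (c - 2, 1 * (c - 2) + (c + 1))),
    ((-c - 2, 0 * (-c - 2) + -1), (c, 0 * c + -1)),
    ((0, -1 * 0 + (c - 1)), (c + 2, -1 * (c + 2) + (c - 1))),
    ((0, 1 * 0 + (c - 1)), (c, 1 * c + (c - 1))),
    ((c - 2, 0 * (c - 2) + (2 * c - 1)), (c + 4, 0 * (c + 4) + (2 * c - 1)))}, ?_⟩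
  simp only [Finset.set_biUnion_insert, Finset.set_biUnion_singleton]
  rw [segment_eq_lineOver _ _ (by linarith), segment_eq_lineOver _ _ (by linarith),
    segment_eq_lineOver _ _ (by linarith), segment_eq_lineOver _ _ (by linarith),
    segment_eq_lineOver _ _ (by linarith), coreGraph]
  simp only [union_assoc]

lemma coreGraph_nonempty {c : ℝ} (hc : 0 ≤ c) : (coreGraph c).Nonempty :=
  ⟨(0, -1), mem_coreGraph.2 (Or.inr (Or.inl ⟨rfl, by linarith, hc⟩))⟩

/-- Cut along the axes, each of the five segments has every piece sent into a single one of the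
five. -/
lemma mapsTo_coreGraph {c : ℝ} (hc : 4 < c) :
    MapsTo (planeMap (-1) c) (coreGraph c) (coreGraph c) := by
  rintro ⟨x, y⟩ h
  rcases mem_coreGraph.1 h with ⟨rfl, h1, h2⟩ | ⟨rfl, h1, h2⟩ | ⟨rfl, h1, h2⟩ | ⟨rfl, h1, h2⟩ |
    ⟨rfl, h1, h2⟩
  · rcases le_total 0 x with hx | hx
    · rw [planeMap_quadrant_one hx (by linarith), mem_coreGraph]
      exact Or.inr (Or.inl ⟨by ring, by linarith, by linarith⟩)
    · rcases le_total 0 (x + (c + 1)) with hy | hy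
      · rw [planeMap_quadrant_two hx hy, mem_coreGraph]
        exact Or.inr (Or.inl ⟨by ring, by linarith, by linarith⟩)
      · rw [planeMap_quadrant_three hx hy, mem_coreGraph]
        exact Or.inr (Or.inr (Or.inl ⟨by ring, by linarith, by linarith⟩))
  · rcases le_total 0 x with hx | hx
    · rw [planeMap_quadrant_four hx (by norm_num), mem_coreGraph]
      exact Or.inr (Or.inr (Or.inr (Or.inl ⟨by ring, by linarith, by linarith⟩)))
    · rw [planeMap_quadrant_three hx (by norm_num), mem_coreGraph]
      exact Or.inr (Or.inr (Or.inl ⟨by ring, by linarith, by linarith⟩))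
  · rcases le_total 0 (-x + (c - 1)) with hy | hy
    · rw [planeMap_quadrant_one h1 hy, mem_coreGraph]
      exact Or.inl ⟨by ring, by linarith, by linarith⟩
    · rw [planeMap_quadrant_four h1 hy, mem_coreGraph]
      exact Or.inr (Or.inr (Or.inr (Or.inr ⟨by ring, by linarith, by linarith⟩)))
  · rw [planeMap_quadrant_one h1 (by linarith), mem_coreGraph]
    exact Or.inl ⟨by ring, by linarith, by linarith⟩
  · rw [planeMap_quadrant_one (by linarith) (by linarith), mem_coreGraph]
    exact Or.inl ⟨by ring, by linarith, by linarith⟩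

/-! ### Absorption of all orbits -/

/-- The fixed point in the second quadrant. -/
noncomputable def repeller (c : ℝ) : ℝ × ℝ := ((-c - 2) / 5, (2 * c - 1) / 5)

lemma planeMap_repeller {c : ℝ} (hc : 4 < c) : planeMap (-1) c (repeller c) = repeller c := by
  rw [repeller, planeMap_quadrant_two (by linarith) (by linarith), Prod.mk.injEq]
  constructor <;> ring

/-- The orbit of `p` enters the core graph or ends at the repeller. -/
def Absorbed (c : ℝ) (p : ℝ × ℝ) : Prop :=
  ∃ n : ℕ, (planeMap (-1) c)^[n] p ∈ coreGraph c ∪ {repeller c}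

lemma Absorbed.of_planeMap {c : ℝ} {p : ℝ × ℝ} (h : Absorbed c (planeMap (-1) c p)) :
    Absorbed c p := by
  obtain ⟨n, hn⟩ := h
  exact ⟨n + 1, by rwa [Function.iterate_succ_apply]⟩

lemma absorbed_of_mem {c : ℝ} {p : ℝ × ℝ} (h : p ∈ coreGraph c) : Absorbed c p := ⟨0, Or.inl h⟩

/-- Points with t ≥ 1 all go to (-c - 2, -1), the left end of the segment in the row y = -1. -/
lemma absorbed_line_of_ge {c t : ℝ} (hc : 4 < c) (ht : -c - 1 ≤ t) :
    Absorbed c (t - 1, t + c) := by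
  rcases le_total t 1 with h1 | h1
  · exact absorbed_of_mem (mem_coreGraph.2 (Or.inl ⟨by ring, by linarith, by linarith⟩))
  · refine Absorbed.of_planeMap ?_
    rw [planeMap_quadrant_one (by linarith) (by linarith)]
    exact absorbed_of_mem (mem_coreGraph.2 (Or.inr (Or.inl ⟨by ring, by linarith, by linarith⟩)))

/-- A point too low on the line passes through quadrants three, four and one and comes back with
parameter -4t - 5c + 1, which is high enough. -/
lemma absorbed_line {c : ℝ} (hc : 4 < c) (t : ℝ) : Absorbed c (t - 1, t + c) := by
  rcases le_total (-c - 1) t with ht | ht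
  · exact absorbed_line_of_ge hc ht
  · refine Absorbed.of_planeMap ?_
    rw [planeMap_quadrant_three (by linarith) (by linarith)]
    refine Absorbed.of_planeMap ?_
    rw [planeMap_quadrant_four (by linarith) (by linarith)]
    refine Absorbed.of_planeMap ?_
    rw [planeMap_quadrant_one (by linarith) (by linarith)]
    have := absorbed_line_of_ge (t := -4 * t - 5 * c + 1) hc (by linarith)
    convert this using 2 <;> ring

lemma absorbed_quadrant_one {c x y : ℝ} (hc : 4 < c) (hx : 0 ≤ x) (hy : 0 ≤ y) :
    Absorbed c (x, y) := by
  refine Absorbed.of_planeMap ?_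
  rw [planeMap_quadrant_one hx hy]
  exact absorbed_line hc (x - y)

/-- The image lies on y = -x + c - 1, and every piece of the part with x ≥ -1 reaches the first
quadrant in a few steps. -/
lemma absorbed_quadrant_three {c x y : ℝ} (hc : 4 < c) (hx : x ≤ 0) (hy : y ≤ 0) :
    Absorbed c (x, y) := by
  refine Absorbed.of_planeMap ?_
  rw [planeMap_quadrant_three hx hy]
  rcases le_total 1 (-x - y) with h1 | h1
  · rcases le_total 0 (x + y + c) with h2 | h2
    · exact absorbed_quadrant_one hc (by linarith) h2
    · refine Absorbed.of_planeMap ?_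
      rw [planeMap_quadrant_four (by linarith) h2]
      exact absorbed_quadrant_one hc (by linarith) (by linarith)
  · refine Absorbed.of_planeMap ?_
    rw [planeMap_quadrant_two (by linarith) (by linarith)]
    refine Absorbed.of_planeMap ?_
    rcases le_total 0 (-x - y - 1 - (x + y + c) + c) with h2 | h2
    · rw [planeMap_quadrant_two (by linarith) h2]
      refine Absorbed.of_planeMap ?_
      rw [planeMap_quadrant_four (by linarith) (by linarith)]
      exact absorbed_quadrant_one hc (by linarith) (by linarith)
    · rw [planeMap_quadrant_three (by linarith) h2]
      refine Absorbed.of_planeMap ?_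
      rw [planeMap_quadrant_four (by linarith) (by linarith)]
      exact absorbed_quadrant_one hc (by linarith) (by linarith)

lemma absorbed_quadrant_four {c x y : ℝ} (hc : 4 < c) (hx : 0 ≤ x) (hy : y ≤ 0) :
    Absorbed c (x, y) := by
  refine Absorbed.of_planeMap ?_
  rw [planeMap_quadrant_four hx hy]
  rcases le_total 0 (x - y - 1) with h1 | h1
  · rcases le_total 0 (x + y + c) with h2 | h2
    · exact absorbed_quadrant_one hc h1 h2
    · refine Absorbed.of_planeMap ?_
      rw [planeMap_quadrant_four h1 h2]
      exact absorbed_quadrant_one hc (by linarith) (by linarith)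
  · refine Absorbed.of_planeMap ?_
    rw [planeMap_quadrant_two h1 (by linarith)]
    rcases le_total (x - y - 1 - (x + y + c) + c) 0 with h2 | h2
    · exact absorbed_quadrant_three hc (by linarith) h2
    · refine Absorbed.of_planeMap ?_
      rw [planeMap_quadrant_two (by linarith) h2]
      set u := -(-(x - y - 1) - (x + y + c) - 1) - (x - y - 1 - (x + y + c) + c) - 1 with hu
      set v := -(x - y - 1) - (x + y + c) - 1 - (x - y - 1 - (x + y + c) + c) + c with hv
      rcases le_total 0 v with h3 | h3
      · exact absorbed_quadrant_one hc (by linarith) h3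
      · refine Absorbed.of_planeMap ?_
        rw [planeMap_quadrant_four (by linarith) h3]
        exact absorbed_quadrant_one hc (by linarith) (by linarith)

lemma nonpos_of_forall_pow_mul_le {r u C : ℝ} (hr : 1 < r) (h : ∀ n : ℕ, r ^ n * u ≤ C) :
    u ≤ 0 := by
  by_contra hu
  obtain ⟨n, hn⟩ := pow_unbounded_of_one_lt (C / u) hr
  rw [div_lt_iff₀ (not_le.1 hu)] at hn
  exact absurd (h n) (not_le.2 hn)

/-- The only orbit that stays in the second quadrant is the repeller. -/
lemma eq_repeller_of_forall_mem {c : ℝ} {p : ℝ × ℝ}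
    (h : ∀ n : ℕ, ((planeMap (-1) c)^[n] p).1 ≤ 0 ∧ 0 ≤ ((planeMap (-1) c)^[n] p).2) :
    p = repeller c := by
  have step : ∀ n : ℕ, (planeMap (-1) c)^[n + 1] p =
      (-((planeMap (-1) c)^[n] p).1 - ((planeMap (-1) c)^[n] p).2 - 1,
        ((planeMap (-1) c)^[n] p).1 - ((planeMap (-1) c)^[n] p).2 + c) := fun n => by
    rw [Function.iterate_succ_apply']
    exact planeMap_quadrant_two (h n).1 (h n).2
  -- In the second quadrant the linear part is √2 times a rotation by 135°, whose fourth power is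
  -- -4.
  have step4 : ∀ n : ℕ, (planeMap (-1) c)^[n + 4] p - repeller c =
      (-4 : ℝ) • ((planeMap (-1) c)^[n] p - repeller c) := fun n => by
    rw [step (n + 3), step (n + 2), step (n + 1), step n]
    ext
    · simp only [repeller, Prod.fst_sub, Prod.smul_fst, smul_eq_mul]; ring
    · simp only [repeller, Prod.snd_sub, Prod.smul_snd, smul_eq_mul]; ring
  have pow : ∀ m n : ℕ, (planeMap (-1) c)^[m + 8 * n] p - repeller c =
      (16 : ℝ) ^ n • ((planeMap (-1) c)^[m] p - repeller c) := fun m n => by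
    induction n with
    | zero => simp
    | succ n ih =>
      rw [show m + 8 * (n + 1) = m + 8 * n + 4 + 4 by ring, step4, step4, ih, smul_smul, smul_smul]
      congr 1
      ring
  have hx : ∀ m : ℕ, ((planeMap (-1) c)^[m] p).1 - (repeller c).1 ≤ 0 := fun m =>
    nonpos_of_forall_pow_mul_le (r := 16) (C := -(repeller c).1) (by norm_num) fun n => by
      have h1 := congrArg Prod.fst (pow m n)
      simp only [Prod.fst_sub, Prod.smul_fst, smul_eq_mul] at h1
      rw [← h1]
      linarith [(h (m + 8 * n)).1]
  have hy : ∀ m : ℕ, -(((planeMap (-1) c)^[m] p).2 - (repeller c).2) ≤ 0 := fun m =>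
    nonpos_of_forall_pow_mul_le (r := 16) (C := (repeller c).2) (by norm_num) fun n => by
      have h1 := congrArg Prod.snd (pow m n)
      simp only [Prod.snd_sub, Prod.smul_snd, smul_eq_mul] at h1
      rw [mul_neg, ← h1]
      linarith [(h (m + 8 * n)).2]
  have h4x := congrArg Prod.fst (step4 0)
  have h4y := congrArg Prod.snd (step4 0)
  simp only [Prod.fst_sub, Prod.snd_sub, Prod.smul_fst, Prod.smul_snd, smul_eq_mul,
    Function.iterate_zero, id] at h4x h4y
  have hx0 := hx 0
  have hy0 := hy 0
  -- The factor -4 turns the one-sided bounds at time 4 into the opposite bounds at time 0.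
  have hx4 := hx (0 + 4)
  have hy4 := hy (0 + 4)
  simp only [Function.iterate_zero, id] at hx0 hy0
  ext <;> linarith

lemma absorbed {c : ℝ} (hc : 4 < c) (p : ℝ × ℝ) : Absorbed c p := by
  by_contra hp
  have hn : ∀ n : ℕ, ¬ Absorbed c ((planeMap (-1) c)^[n] p) := fun n => by
    induction n with
    | zero => exact hp
    | succ n ih =>
      rw [Function.iterate_succ_apply']
      exact fun h => ih h.of_planeMap
  have key : ∀ q : ℝ × ℝ, ¬ Absorbed c q → q.1 ≤ 0 ∧ 0 ≤ q.2 := by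
    rintro ⟨x, y⟩ hq
    rcases le_total 0 x with hx | hx <;> rcases le_total 0 y with hy | hy
    · exact absurd (absorbed_quadrant_one hc hx hy) hq
    · exact absurd (absorbed_quadrant_four hc hx hy) hq
    · exact ⟨hx, hy⟩
    · exact absurd (absorbed_quadrant_three hc hx hy) hq
  exact hp ⟨0, Or.inr (eq_repeller_of_forall_mem fun n => key _ (hn n))⟩

theorem isInvariantGraph_coreGraph {c : ℝ} (hc : 4 < c) : IsInvariantGraph (-1) c (coreGraph c) where
  graph := isCompactGraph_coreGraph (by linarith)
  nonempty := coreGraph_nonempty (by linarith)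
  invariant := mapsTo_coreGraph hc
  absorbing := ⟨{repeller c}, finite_singleton _, by
    rintro _ rfl
    exact Function.mk_mem_periodicPts one_pos
      (Function.IsFixedPt.isPeriodicPt (planeMap_repeller hc) 1), absorbed hc⟩

end CoreGraph

/-! ### The return map on the line y = x + c + 1 and deviations near c = 8 -/

section NearEight

lemma quadrant_one {x y : ℝ} (hx : 0 ≤ x) (hy : 0 ≤ y) : quadrant (x, y) = (true, true) := by
  simp [quadrant, hx, hy]

lemma quadrant_two {x y : ℝ} (hx : x < 0) (hy : 0 ≤ y) : quadrant (x, y) = (false, true) := by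
  simp [quadrant, hx, hy]

lemma quadrant_three {x y : ℝ} (hx : x < 0) (hy : y < 0) : quadrant (x, y) = (false, false) := by
  simp [quadrant, hx, hy]

lemma quadrant_four {x y : ℝ} (hx : 0 ≤ x) (hy : y < 0) : quadrant (x, y) = (true, false) := by
  simp [quadrant, hx, hy]

/-- The parametrization of the line `y = x + c + 1` that contains the image of the first
quadrant. -/
def linePoint (c t : ℝ) : ℝ × ℝ := (t - 1, t + c)

/-- The number of deviations in the first `n` steps from the point `x`. -/
noncomputable def deviationCount (c : ℝ) (x : ℝ × ℝ) (n : ℕ) : ℕ :=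
  hits (planeMap (-1) c) (Deviates (-1) c) x n

/-- The quadrants of the first three points of an orbit. -/
noncomputable def pattern (c : ℝ) (x : ℝ × ℝ) : (Bool × Bool) × (Bool × Bool) × (Bool × Bool) :=
  (quadrant x, quadrant (planeMap (-1) c x), quadrant (planeMap (-1) c (planeMap (-1) c x)))

/-- Deviations at times 0, 1, 2 compare the quadrants at times 0, 1, 2 with those at times 3, 4, 5.
-/
lemma deviationCount_three {c : ℝ} {x : ℝ × ℝ}
    (h : pattern c ((planeMap (-1) c)^[3] x) = pattern c x) : deviationCount c x 3 = 0 := by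
  classical
  simp only [pattern, Prod.mk.injEq] at h
  obtain ⟨h0, h1, h2⟩ := h
  rw [deviationCount, hits]
  refine Finset.sum_eq_zero fun k hk => if_neg (not_not.2 ?_)
  have hk : k < 3 := Finset.mem_range.1 hk
  interval_cases k
  · exact h0
  · exact h1
  · exact h2

/-- Skipping k steps loses at most k deviations. -/
lemma deviationCount_le_add (c : ℝ) (x : ℝ × ℝ) (k n : ℕ) :
    deviationCount c x n ≤ k + deviationCount c ((planeMap (-1) c)^[k] x) n := by
  refine (hits_mono _ _ _ (Nat.le_add_left n k)).trans ?_
  rw [hits_add]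
  exact Nat.add_le_add_right (hits_le _ _ _ _) _

lemma deviationCount_add (c : ℝ) (x : ℝ × ℝ) (m n : ℕ) : deviationCount c x (m + n) =
    deviationCount c x m + deviationCount c ((planeMap (-1) c)^[m] x) n :=
  hits_add _ _ _ _ _

variable {c t : ℝ}

lemma planeMap_linePoint_middle (h1 : -c ≤ t) (h2 : t ≤ 1) :
    planeMap (-1) c (linePoint c t) = (-2 * t - c, -1) := by
  rw [linePoint, planeMap_quadrant_two (by linarith) (by linarith), Prod.mk.injEq]
  constructor <;> ring

lemma planeMap_row_nonneg {x : ℝ} (hx : 0 ≤ x) : planeMap (-1) c (x, -1) = (x, x + c - 1) := by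
  rw [planeMap_quadrant_four hx (by norm_num), Prod.mk.injEq]
  constructor <;> ring

lemma planeMap_row_nonpos {x : ℝ} (hx : x ≤ 0) : planeMap (-1) c (x, -1) = (-x, x + c - 1) := by
  rw [planeMap_quadrant_three hx (by norm_num), Prod.mk.injEq]
  constructor <;> ring

lemma iterate_linePoint_low (hc : 4 < c) (h2 : t ≤ -c) :
    (planeMap (-1) c)^[3] (linePoint c t) = linePoint c (-4 * t - 5 * c + 1) := by
  rw [Function.iterate_succ_apply, linePoint, planeMap_quadrant_three (by linarith) (by linarith),
    Function.iterate_succ_apply, planeMap_quadrant_four (by linarith) (by linarith),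
    Function.iterate_one, planeMap_quadrant_one (by linarith) (by linarith), linePoint,
    Prod.mk.injEq]
  constructor <;> ring

/-- The second image lies on a line of slope 1 in the first quadrant, which the next step collapses
to a point. Its parameter 1 - c is in the same interval, so the orbit is trapped. -/
lemma iterate_linePoint_trapped (hc : 4 < c) (h1 : -c ≤ t) (h2 : t ≤ -c / 2) :
    (planeMap (-1) c)^[3] (linePoint c t) = linePoint c (1 - c) := by
  rw [Function.iterate_succ_apply, planeMap_linePoint_middle h1 (by linarith),
    Function.iterate_succ_apply, planeMap_row_nonneg (by linarith),
    Function.iterate_one, planeMap_quadrant_one (by linarith) (by linarith), linePoint,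
    Prod.mk.injEq]
  constructor <;> ring

lemma pattern_trapped (hc : 4 < c) (h1 : -c ≤ t) (h2 : t ≤ -c / 2) :
    pattern c (linePoint c t) = ((false, true), (true, false), (true, true)) := by
  rw [pattern, planeMap_linePoint_middle h1 (by linarith), planeMap_row_nonneg (by linarith),
    quadrant_four (x := -2 * t - c) (by linarith) (by norm_num),
    quadrant_one (x := -2 * t - c) (by linarith) (by linarith)]
  exact congrArg (·, _) (quadrant_two (x := t - 1) (y := t + c) (by linarith) (by linarith))

lemma iterate_linePoint_expand (hc : 4 < c) (h1 : -c / 2 ≤ t) (h2 : t ≤ -1 / 2) :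
    (planeMap (-1) c)^[3] (linePoint c t) = linePoint c (4 * t + c + 1) := by
  rw [Function.iterate_succ_apply, planeMap_linePoint_middle (by linarith) (by linarith),
    Function.iterate_succ_apply, planeMap_row_nonpos (by linarith),
    Function.iterate_one, planeMap_quadrant_one (by linarith) (by linarith), linePoint,
    Prod.mk.injEq]
  constructor <;> ring

lemma pattern_expand (hc : 4 < c) (h1 : -c / 2 < t) (h2 : t ≤ -1 / 2) :
    pattern c (linePoint c t) = ((false, true), (false, false), (true, true)) := by
  rw [pattern, planeMap_linePoint_middle (by linarith) (by linarith),
    planeMap_row_nonpos (by linarith),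
    quadrant_three (x := -2 * t - c) (by linarith) (by norm_num),
    quadrant_one (x := -(-2 * t - c)) (by linarith) (by linarith)]
  exact congrArg (·, _) (quadrant_two (x := t - 1) (y := t + c) (by linarith) (by linarith))

/-- For t ≥ -1/2 the second image falls below the horizontal axis, which costs one extra step; the
return parameter is at most 5 - c. -/
lemma iterate_linePoint_high (hc : 4 < c) (h1 : -1 / 2 ≤ t) (h2 : t ≤ 1) :
    (planeMap (-1) c)^[4] (linePoint c t) = linePoint c (4 * t - c + 1) := by
  rw [Function.iterate_succ_apply, planeMap_linePoint_middle (by linarith) h2,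
    Function.iterate_succ_apply, planeMap_row_nonpos (by linarith),
    Function.iterate_succ_apply, planeMap_quadrant_four (by linarith) (by linarith),
    Function.iterate_one, planeMap_quadrant_one (by linarith) (by linarith), linePoint,
    Prod.mk.injEq]
  constructor <;> ring

lemma iterate_linePoint_top (hc : 4 < c) (h1 : 1 ≤ t) :
    (planeMap (-1) c)^[4] (linePoint c t) = linePoint c (5 - c) := by
  rw [Function.iterate_succ_apply, linePoint, planeMap_quadrant_one (by linarith) (by linarith),
    Function.iterate_succ_apply, planeMap_quadrant_three (by linarith) (by linarith),
    Function.iterate_succ_apply, planeMap_quadrant_four (by linarith) (by linarith),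
    Function.iterate_one, planeMap_quadrant_one (by linarith) (by linarith), linePoint,
    Prod.mk.injEq]
  constructor <;> ring

lemma deviationCount_trapped (hc : 4 < c) (h1 : -c ≤ t) (h2 : t ≤ -c / 2) (n : ℕ) :
    deviationCount c (linePoint c t) n = 0 := by
  induction n using Nat.strong_induction_on generalizing t with
  | _ n ih =>
    have h3 : deviationCount c (linePoint c t) 3 = 0 := by
      apply deviationCount_three
      rw [iterate_linePoint_trapped hc h1 h2, pattern_trapped hc h1 h2,
        pattern_trapped hc (by linarith) (by linarith)]
    rcases le_or_gt n 3 with hn | hn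
    · have := hits_mono (planeMap (-1) c) (Deviates (-1) c) (linePoint c t) hn
      rw [deviationCount] at h3 ⊢
      omega
    · obtain ⟨k, rfl⟩ := Nat.exists_eq_add_of_lt hn
      rw [add_assoc, deviationCount_add, h3, iterate_linePoint_trapped hc h1 h2,
        ih (k + 1) (by omega) (by linarith) (by linarith)]

lemma deviationCount_expand (hc : 4 < c) (h1 : -c / 2 < t) (h2 : t ≤ -1 / 2)
    (h1' : -c / 2 < 4 * t + c + 1) (h2' : 4 * t + c + 1 ≤ -1 / 2) :
    deviationCount c (linePoint c t) 3 = 0 := by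
  apply deviationCount_three
  rw [iterate_linePoint_expand hc h1.le h2, pattern_expand hc h1 h2, pattern_expand hc h1' h2']

/-- To the left of the fixed point `-(c + 1) / 3` there is at most one block of deviations. -/
lemma deviationCount_left (hc : 4 < c) (h1 : -c / 2 < t) (h2 : t ≤ -(c + 1) / 3) (n : ℕ) :
    deviationCount c (linePoint c t) n ≤ 3 := by
  induction n using Nat.strong_induction_on generalizing t with
  | _ n ih =>
    rcases le_or_gt n 3 with hn | hn
    · exact (hits_le _ _ _ _).trans hn
    -- Either the orbit drops into the trapped interval, and only the three steps before can
    -- deviate, or the expansion continues without deviation.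
    · rcases le_or_gt (4 * t + c + 1) (-c / 2) with h | h
      · refine (deviationCount_le_add c _ 3 n).trans ?_
        rw [iterate_linePoint_expand hc h1.le (by linarith),
          deviationCount_trapped hc (by linarith) h]
      · obtain ⟨k, rfl⟩ := Nat.exists_eq_add_of_lt hn
        rw [add_assoc, deviationCount_add,
          deviationCount_expand hc h1 (by linarith) h (by linarith),
          iterate_linePoint_expand hc h1.le (by linarith), zero_add]
        exact ih (k + 1) (by omega) h (by linarith)

/-- To the right of the fixed point, and close to it, there is no deviation for a long time. -/
lemma deviationCount_right (hc : 7 < c) (h1 : -(c + 1) / 3 ≤ t) (j : ℕ)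
    (hj : 4 ^ j * (t + (c + 1) / 3) ≤ 2) :
    deviationCount c (linePoint c t) (3 * j) = 0 ∧
      (planeMap (-1) c)^[3 * j] (linePoint c t) =
        linePoint c (-(c + 1) / 3 + 4 ^ j * (t + (c + 1) / 3)) := by
  induction j generalizing t with
  | zero =>
    refine ⟨hits_zero _ _ _, ?_⟩
    simp only [Nat.mul_zero, Function.iterate_zero, id, pow_zero, one_mul]
    congr 1; ring
  | succ j ih =>
    have hp : (1 : ℝ) ≤ 4 ^ j := one_le_pow₀ (by norm_num)
    have h0 : 0 ≤ t + (c + 1) / 3 := by linarith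
    have h4 : 4 * (t + (c + 1) / 3) ≤ 2 := by
      rw [pow_succ] at hj
      nlinarith
    -- The bound 2 keeps this point and the next below -1/2, as -(c + 1)/3 + 2 < -1/2 for c > 7.
    have ht : t ≤ -1 / 2 := by linarith
    have ht' : 4 * t + c + 1 ≤ -1 / 2 := by linarith
    have hj' : 4 ^ j * (4 * t + c + 1 + (c + 1) / 3) ≤ 2 := by
      rw [pow_succ] at hj
      linarith
    obtain ⟨i1, i2⟩ := ih (t := 4 * t + c + 1) (by linarith) hj'
    have e := iterate_linePoint_expand (c := c) (t := t) (by linarith) (by linarith) ht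
    rw [show 3 * (j + 1) = 3 + 3 * j by ring, deviationCount_add, e, i1,
      deviationCount_expand (by linarith) (by linarith) ht (by linarith) ht', Nat.add_comm 3,
      Function.iterate_add_apply, e, i2]
    refine ⟨rfl, ?_⟩
    congr 1; ring

/-- To the right of the fixed point, t exceeds it by at most 2(8 - c)/3, so 3N steps pass without
deviation and the gain 3Nδ ≥ 10 lowers the constant 13 to 3. The next lemmas spend it again: 3 on a
low start, 4 on a high return and 3 on the block leading there, so 3, 6, 10, 13 closes the
induction. `hR` is its hypothesis for shorter times. -/
lemma deviationCount_near {δ : ℝ} {N : ℕ} (hc : 7 < c) (hN : 0 < N)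
    (hcN : 4 ^ N * (2 * (8 - c) / 3) ≤ 2) (hδ : 10 ≤ 3 * N * δ) (hδ0 : 0 ≤ δ) {n : ℕ}
    (hR : ∀ k < n, ∀ t, -(c + 1) / 3 ≤ t → t ≤ -1 / 2 →
      (deviationCount c (linePoint c t) k : ℝ) ≤ δ * k + 13)
    (h1 : -c / 2 < t) (h2 : t ≤ 5 - c) :
    (deviationCount c (linePoint c t) n : ℝ) ≤ δ * n + 3 := by
  have hδn : 0 ≤ δ * n := by positivity
  rcases le_total t (-(c + 1) / 3) with ht | ht
  · have : (deviationCount c (linePoint c t) n : ℝ) ≤ 3 := by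
      exact_mod_cast deviationCount_left (by linarith) h1 ht n
    linarith
  · have hp : (0 : ℝ) < 4 ^ N := by positivity
    have htN : 4 ^ N * (t + (c + 1) / 3) ≤ 2 :=
      (mul_le_mul_of_nonneg_left (by linarith) hp.le).trans hcN
    obtain ⟨e1, e2⟩ := deviationCount_right hc ht N htN
    rcases le_or_gt n (3 * N) with hn | hn
    · have h0 : deviationCount c (linePoint c t) n = 0 :=
        Nat.le_zero.1 ((hits_mono _ _ _ hn).trans e1.le)
      rw [h0]
      push_cast
      linarith
    · obtain ⟨k, rfl⟩ := Nat.exists_eq_add_of_lt hn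
      rw [add_assoc, deviationCount_add, e1, e2, zero_add]
      have h0 : 0 ≤ 4 ^ N * (t + (c + 1) / 3) := mul_nonneg hp.le (by linarith)
      refine (hR (k + 1) (by omega) _ (by linarith) (by linarith)).trans ?_
      push_cast
      nlinarith

lemma deviationCount_base {δ : ℝ} {N : ℕ} (hc : 7 < c) (hN : 0 < N)
    (hcN : 4 ^ N * (2 * (8 - c) / 3) ≤ 2) (hδ : 10 ≤ 3 * N * δ) (hδ0 : 0 ≤ δ) {n : ℕ}
    (hR : ∀ k < n, ∀ t, -(c + 1) / 3 ≤ t → t ≤ -1 / 2 →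
      (deviationCount c (linePoint c t) k : ℝ) ≤ δ * k + 13)
    (h1 : -c - 1 ≤ t) (h2 : t ≤ 5 - c) :
    (deviationCount c (linePoint c t) n : ℝ) ≤ δ * n + 6 := by
  have hδn : 0 ≤ δ * n := by positivity
  have main : ∀ t, -c ≤ t → t ≤ 5 - c →
      (deviationCount c (linePoint c t) n : ℝ) ≤ δ * n + 3 := fun t h1 h2 => by
    rcases le_or_gt t (-c / 2) with h | h
    · rw [deviationCount_trapped (by linarith) h1 h]
      push_cast
      linarith
    · exact deviationCount_near hc hN hcN hδ hδ0 hR h h2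
  rcases le_total t (-c) with h | h
  · have e := deviationCount_le_add c (linePoint c t) 3 n
    rw [iterate_linePoint_low (by linarith) h] at e
    have e' : (deviationCount c (linePoint c t) n : ℝ) ≤
      3 + deviationCount c (linePoint c (-4 * t - 5 * c + 1)) n := by exact_mod_cast e
    have := main (-4 * t - 5 * c + 1) (by linarith) (by linarith)
    linarith
  · have := main t h h2
    linarith

lemma deviationCount_upper {δ : ℝ} {N : ℕ} (hc : 7 < c) (hN : 0 < N)
    (hcN : 4 ^ N * (2 * (8 - c) / 3) ≤ 2) (hδ : 10 ≤ 3 * N * δ) (hδ0 : 0 ≤ δ) {n : ℕ}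
    (hR : ∀ k < n, ∀ t, -(c + 1) / 3 ≤ t → t ≤ -1 / 2 →
      (deviationCount c (linePoint c t) k : ℝ) ≤ δ * k + 13)
    (h1 : -1 / 2 ≤ t) : (deviationCount c (linePoint c t) n : ℝ) ≤ δ * n + 10 := by
  have e := deviationCount_le_add c (linePoint c t) 4 n
  have e' : (deviationCount c (linePoint c t) n : ℝ) ≤
      4 + deviationCount c ((planeMap (-1) c)^[4] (linePoint c t)) n := by exact_mod_cast e
  rcases le_total t 1 with h | h
  · rw [iterate_linePoint_high (by linarith) h1 h] at e'
    have := deviationCount_base (t := 4 * t - c + 1) hc hN hcN hδ hδ0 hR (by linarith)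
      (by linarith)
    linarith
  · rw [iterate_linePoint_top (by linarith) h] at e'
    have := deviationCount_base (t := 5 - c) hc hN hcN hδ hδ0 hR (by linarith) le_rfl
    linarith

lemma deviationCount_expanding {δ : ℝ} {N : ℕ} (hc : 7 < c) (hN : 0 < N)
    (hcN : 4 ^ N * (2 * (8 - c) / 3) ≤ 2) (hδ : 10 ≤ 3 * N * δ) (hδ0 : 0 ≤ δ) (n : ℕ) : ∀ t, -(c + 1) / 3 ≤ t → t ≤ -1 / 2 →
    (deviationCount c (linePoint c t) n : ℝ) ≤ δ * n + 13 := by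
  induction n using Nat.strong_induction_on with
  | _ n ih =>
    intro t h1 h2
    have hδn : 0 ≤ δ * n := by positivity
    rcases le_or_gt n 3 with hn | hn
    · have h3 : deviationCount c (linePoint c t) n ≤ 3 := (hits_le _ _ _ _).trans hn
      have : (deviationCount c (linePoint c t) n : ℝ) ≤ 3 := by exact_mod_cast h3
      linarith
    have e := iterate_linePoint_expand (c := c) (t := t) (by linarith) (by linarith) h2
    rcases le_total (4 * t + c + 1) (-1 / 2) with h | h
    · obtain ⟨k, rfl⟩ := Nat.exists_eq_add_of_lt hn
      rw [add_assoc, deviationCount_add, e,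
        deviationCount_expand (by linarith) (by linarith) h2 (by linarith) h, zero_add]
      refine (ih (k + 1) (by omega) _ (by linarith) h).trans ?_
      push_cast
      linarith
    · have e1 := deviationCount_le_add c (linePoint c t) 3 n
      rw [e] at e1
      have e2 : (deviationCount c (linePoint c t) n : ℝ) ≤
        3 + deviationCount c (linePoint c (4 * t + c + 1)) n := by exact_mod_cast e1
      have := deviationCount_upper hc hN hcN hδ hδ0 ih h
      linarith

/-- The bound c < 9 gives -c/2 ≤ 5 - c, so that the low and trapped parameters fall under
`deviationCount_base`. -/
lemma deviationCount_linePoint {δ : ℝ} {N : ℕ} (hc : 7 < c) (hc' : c < 9) (hN : 0 < N)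
    (hcN : 4 ^ N * (2 * (8 - c) / 3) ≤ 2) (hδ : 10 ≤ 3 * N * δ) (hδ0 : 0 ≤ δ) (n : ℕ) (h1 : -c - 1 ≤ t) :
    (deviationCount c (linePoint c t) n : ℝ) ≤ δ * n + 13 := by
  have hR : ∀ k < n, ∀ t, -(c + 1) / 3 ≤ t → t ≤ -1 / 2 →
      (deviationCount c (linePoint c t) k : ℝ) ≤ δ * k + 13 :=
    fun k _ => deviationCount_expanding hc hN hcN hδ hδ0 k
  have hδn : 0 ≤ δ * n := by positivity
  rcases le_or_gt t (-c / 2) with h2 | h2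
  · linarith [deviationCount_base hc hN hcN hδ hδ0 hR h1 (by linarith)]
  rcases le_total t (-(c + 1) / 3) with h3 | h3
  · have : (deviationCount c (linePoint c t) n : ℝ) ≤ 3 := by
      exact_mod_cast deviationCount_left (by linarith) h2 h3 n
    linarith
  rcases le_total t (-1 / 2) with h4 | h4
  · exact deviationCount_expanding hc hN hcN hδ hδ0 n t h3 h4
  · linarith [deviationCount_upper hc hN hcN hδ hδ0 hR h4]


lemma exists_iterate_eq_linePoint (hc : 4 < c) {p : ℝ × ℝ} (hp : p ∈ coreGraph c) :
    ∃ k ≤ 3, ∃ t, -c - 1 ≤ t ∧ (planeMap (-1) c)^[k] p = linePoint c t := by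
  have diag : ∀ x : ℝ, 0 ≤ x → x ≤ c + 2 →
      ∃ k ≤ 2, ∃ t, -c - 1 ≤ t ∧ (planeMap (-1) c)^[k] (x, -x + (c - 1)) = linePoint c t := by
    intro x h1 h2
    rcases le_total 0 (-x + (c - 1)) with hy | hy
    · refine ⟨1, by norm_num, 2 * x - c + 1, by linarith, ?_⟩
      rw [Function.iterate_one, planeMap_quadrant_one h1 hy, linePoint, Prod.mk.injEq]
      constructor <;> ring
    · refine ⟨2, le_rfl, 2 * x - 3 * c + 1, by linarith, ?_⟩
      rw [Function.iterate_succ_apply, Function.iterate_one, planeMap_quadrant_four h1 hy,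
        planeMap_quadrant_one (by linarith) (by linarith), linePoint, Prod.mk.injEq]
      constructor <;> ring
  obtain ⟨x, y⟩ := p
  rcases mem_coreGraph.1 hp with ⟨rfl, h1, h2⟩ | ⟨rfl, h1, h2⟩ | ⟨rfl, h1, h2⟩ | ⟨rfl, h1, h2⟩ |
    ⟨rfl, h1, h2⟩
  · refine ⟨0, by norm_num, x + 1, by linarith, ?_⟩
    rw [Function.iterate_zero, id, linePoint, Prod.mk.injEq]
    constructor <;> ring
  · rcases le_total 0 x with hx | hx
    · refine ⟨2, by norm_num, 1 - c, by linarith, ?_⟩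
      rw [Function.iterate_succ_apply, Function.iterate_one, planeMap_row_nonneg hx,
        planeMap_quadrant_one hx (by linarith), linePoint, Prod.mk.injEq]
      constructor <;> ring
    · obtain ⟨k, hk, t, ht, e⟩ := diag (-x) (by linarith) (by linarith)
      refine ⟨k + 1, by omega, t, ht, ?_⟩
      rw [Function.iterate_succ_apply, planeMap_row_nonpos hx, ← e]
      congr 2; ring
  · obtain ⟨k, hk, h⟩ := diag x h1 h2
    exact ⟨k, by omega, h⟩
  · refine ⟨1, by norm_num, 1 - c, by linarith, ?_⟩
    rw [Function.iterate_one, planeMap_quadrant_one h1 (by linarith), linePoint, Prod.mk.injEq]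
    constructor <;> ring
  · refine ⟨1, by norm_num, x - 2 * c + 1, by linarith, ?_⟩
    rw [Function.iterate_one, planeMap_quadrant_one (by linarith) (by linarith), linePoint,
      Prod.mk.injEq]
    constructor <;> ring

/-- Near `c = 8`, deviations from 3-periodicity have small frequency. -/
lemma eventually_hits_deviates_le {δ : ℝ} (hδ : 0 < δ) :
    ∀ᶠ c in 𝓝 (8 : ℝ), ∀ x ∈ coreGraph c, ∀ n,
      (hits (planeMap (-1) c) (Deviates (-1) c) x n : ℝ) ≤ δ * n + 16 := by
  -- The number of quiet rounds depends on δ only; c is then taken so close to 8 that the gap,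
  -- multiplied by 4 ^ N, stays below 2.
  obtain ⟨N, hN⟩ := exists_nat_ge (10 / (3 * δ))
  have hN0 : 0 < N := by
    have : (0 : ℝ) < N := lt_of_lt_of_le (by positivity) hN
    exact_mod_cast this
  have hNδ : 10 ≤ 3 * N * δ := by
    rw [div_le_iff₀ (by positivity)] at hN
    linarith
  have hcont : Tendsto (fun c : ℝ => (4 : ℝ) ^ N * (2 * (8 - c) / 3)) (𝓝 8)
      (𝓝 ((4 : ℝ) ^ N * (2 * (8 - 8) / 3))) := (by fun_prop : Continuous _).tendsto _
  filter_upwards [hcont.eventually_lt_const (u := 2) (by norm_num), lt_mem_nhds (by norm_num : (7 : ℝ) < 8),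
    gt_mem_nhds (by norm_num : (8 : ℝ) < 9)] with c h1 h2 h3 x hx n
  obtain ⟨k, hk, t, ht, e⟩ := exists_iterate_eq_linePoint (by linarith) hx
  have e1 := deviationCount_le_add c x k n
  rw [e] at e1
  have e2 : (deviationCount c x n : ℝ) ≤ 3 + deviationCount c (linePoint c t) n := by
    exact_mod_cast e1.trans (by omega)
  have := deviationCount_linePoint h2 h3 hN0 h1.le hNδ hδ.le n ht
  rw [deviationCount] at e2
  linarith

end NearEight

/-! ### The entropy function, scaling and continuity -/

section EntropyFunction

lemma continuous_planeMap (a b : ℝ) : Continuous (planeMap a b) := by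
  unfold planeMap
  fun_prop

/-- The orbits of finitely many periodic points form a finite set. -/
lemma finite_biUnion_orbit {X : Type*} {T : X → X} {E : Set X} (hE : E.Finite)
    (hper : E ⊆ Function.periodicPts T) : (⋃ e ∈ E, range fun n : ℕ => T^[n] e).Finite := by
  classical
  refine hE.biUnion fun e he => ?_
  obtain ⟨k, hk, hke⟩ := hper he
  refine ((Finset.range k).image fun n => T^[n] e).finite_toSet.subset ?_
  rintro _ ⟨n, rfl⟩
  rw [Finset.coe_image]
  exact ⟨n % k, Finset.mem_coe.2 (Finset.mem_range.2 (Nat.mod_lt _ hk)), hke.iterate_mod_apply n⟩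

/-- The entropy does not depend on the invariant graph. -/
theorem IsInvariantGraph.coverEntropy_le {a b : ℝ} {Γ Γ' : Set (ℝ × ℝ)}
    (h : IsInvariantGraph a b Γ) (h' : IsInvariantGraph a b Γ') :
    Dynamics.coverEntropy (planeMap a b) Γ ≤ Dynamics.coverEntropy (planeMap a b) Γ' := by
  obtain ⟨E, hE, hper, habs⟩ := h'.absorbing
  -- `E` need not be forward invariant; the union of its orbits is, and it is still finite, hence of
  -- zero entropy.
  set O := ⋃ e ∈ E, range fun n : ℕ => (planeMap a b)^[n] e with hO
  have hOO : MapsTo (planeMap a b) O O := by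
    intro x hx
    obtain ⟨e, he, n, rfl⟩ := mem_iUnion₂.1 hx
    exact mem_iUnion₂.2 ⟨e, he, n + 1, Function.iterate_succ_apply' _ _ _⟩
  have hEO : E ⊆ O := fun e he => mem_iUnion₂.2 ⟨e, he, 0, rfl⟩
  have h1 := coverEntropy_le_of_forall_exists_iterate_mem (continuous_planeMap a b)
    h.graph.isCompact h.invariant (A := Γ' ∪ O) (h'.invariant.union_union hOO)
    fun x _ => (habs x).imp fun n hn => union_subset_union_right _ hEO hn
  rw [Dynamics.coverEntropy_union] at h1
  refine h1.trans (max_le le_rfl ?_)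
  exact (coverEntropy_le_zero_of_finite (finite_biUnion_orbit hE hper) _).trans
    (Dynamics.coverEntropy_nonneg _ h'.nonempty)

theorem IsInvariantGraph.coverEntropy_eq {a b : ℝ} {Γ Γ' : Set (ℝ × ℝ)}
    (h : IsInvariantGraph a b Γ) (h' : IsInvariantGraph a b Γ') :
    Dynamics.coverEntropy (planeMap a b) Γ = Dynamics.coverEntropy (planeMap a b) Γ' :=
  le_antisymm (h.coverEntropy_le h') (h'.coverEntropy_le h)

/-- The map is positively homogeneous in the point and the parameters jointly, so only the ratio
-b/a matters when a < 0. -/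
lemma semiconj_smul (a b : ℝ) {r : ℝ} (hr : 0 < r) :
    Function.Semiconj (fun p : ℝ × ℝ => r • p) (planeMap a b) (planeMap (r * a) (r * b)) := by
  intro p
  simp only [planeMap]
  ext
  · simp only [Prod.smul_fst, Prod.smul_snd, smul_eq_mul, abs_mul, abs_of_pos hr]; ring
  · simp only [Prod.smul_fst, Prod.smul_snd, smul_eq_mul, abs_mul, abs_of_pos hr]; ring

lemma IsInvariantGraph.smul {a b : ℝ} {Γ : Set (ℝ × ℝ)} (h : IsInvariantGraph a b Γ) {r : ℝ}
    (hr : 0 < r) : IsInvariantGraph (r * a) (r * b) ((fun p => r • p) '' Γ) := by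
  classical
  have hsc := semiconj_smul a b hr
  refine ⟨?_, h.nonempty.image _, ?_, ?_⟩
  · obtain ⟨S, rfl⟩ := h.graph
    refine ⟨S.image fun s => (r • s.1, r • s.2), ?_⟩
    rw [image_iUnion₂, Finset.set_biUnion_finset_image]
    refine iUnion₂_congr fun s _ => ?_
    exact image_segment ℝ (LinearMap.lsmul ℝ (ℝ × ℝ) r).toAffineMap s.1 s.2
  · rintro _ ⟨x, hx, rfl⟩
    exact ⟨planeMap a b x, h.invariant hx, hsc x⟩
  · obtain ⟨E, hE, hper, habs⟩ := h.absorbing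
    refine ⟨(fun p => r • p) '' E, hE.image _, ?_, fun x => ?_⟩
    · rintro _ ⟨e, he, rfl⟩
      obtain ⟨k, hk, hke⟩ := hper he
      refine ⟨k, hk, ?_⟩
      have := (hsc.iterate_right k) e
      rw [hke.eq] at this
      exact this.symm
    · obtain ⟨n, hn⟩ := habs (r⁻¹ • x)
      refine ⟨n, ?_⟩
      have := (hsc.iterate_right n) (r⁻¹ • x)
      simp only [smul_inv_smul₀ hr.ne'] at this
      rw [← this, ← image_union]
      exact mem_image_of_mem _ hn

lemma coverEntropy_smul (a b : ℝ) (Γ : Set (ℝ × ℝ)) {r : ℝ} (hr : 0 < r) :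
    Dynamics.coverEntropy (planeMap (r * a) (r * b)) ((fun p => r • p) '' Γ) =
      Dynamics.coverEntropy (planeMap a b) Γ := by
  refine le_antisymm (Dynamics.coverEntropy_image_le_of_uniformContinuous (semiconj_smul a b hr)
    (uniformContinuous_const_smul r) Γ) ?_
  have h := Dynamics.coverEntropy_image_le_of_uniformContinuous
    (semiconj_smul (r * a) (r * b) (inv_pos.2 hr))
    (uniformContinuous_const_smul r⁻¹) ((fun p => r • p) '' Γ)
  rw [image_image] at h
  simpa only [inv_smul_smul₀ hr.ne', image_id', inv_mul_cancel_left₀ hr.ne'] using h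

lemma IsInvariantGraph.coe_toReal_coverEntropy {a b : ℝ} {Γ : Set (ℝ × ℝ)}
    (h : IsInvariantGraph a b Γ) :
    ((Dynamics.coverEntropy (planeMap a b) Γ).toReal : EReal) =
      Dynamics.coverEntropy (planeMap a b) Γ := by
  refine EReal.coe_toReal ?_ ?_
  · exact ((coverEntropy_le_log_four h.graph h.invariant).trans_lt (EReal.coe_lt_top _)).ne
  · exact ((EReal.bot_lt_zero).trans_le (Dynamics.coverEntropy_nonneg _ h.nonempty)).ne'

open Classical in
/-- The entropy of `planeMap (-1) c` on any of its invariant graphs. -/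
noncomputable def graphEntropy (c : ℝ) : ℝ :=
  -- The default 0 concerns only parameters without an invariant graph, where nothing is claimed
  -- about the value.
  if H : ∃ Γ, IsInvariantGraph (-1) c Γ then
    (Dynamics.coverEntropy (planeMap (-1) c) H.choose).toReal else 0

lemma IsInvariantGraph.coverEntropy_eq_graphEntropy {c : ℝ} {Γ : Set (ℝ × ℝ)}
    (h : IsInvariantGraph (-1) c Γ) :
    Dynamics.coverEntropy (planeMap (-1) c) Γ = (graphEntropy c : EReal) := by
  have H : ∃ Γ, IsInvariantGraph (-1) c Γ := ⟨Γ, h⟩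
  rw [graphEntropy, dif_pos H, H.choose_spec.coe_toReal_coverEntropy]
  exact h.coverEntropy_eq H.choose_spec

lemma eventually_graphEntropy_mem {ε : ℝ} (hε : 0 < ε) :
    ∀ᶠ c in 𝓝 (8 : ℝ), graphEntropy c ∈ Icc 0 ε := by
  -- First z makes log(1 + 4z) at most ε/2; then δ is chosen so that -δ log z is at most ε/2.
  set z := min 1 (ε / 8) with hz
  have hz0 : 0 < z := lt_min one_pos (by positivity)
  have hz1 : z ≤ 1 := min_le_left _ _
  have hlz : 0 ≤ -Real.log z := neg_nonneg.2 (Real.log_nonpos hz0.le hz1)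
  set δ := ε / 2 / (-Real.log z + 1) with hδ
  have hδ0 : 0 < δ := by positivity
  have hδz : δ * -Real.log z ≤ ε / 2 := by
    have : δ * (-Real.log z + 1) = ε / 2 := div_mul_cancel₀ _ (by linarith)
    linarith
  have hlog : Real.log (1 + 4 * z) ≤ ε / 2 := by
    have h1 := Real.log_le_sub_one_of_pos (by linarith : 0 < 1 + 4 * z)
    have h2 : z ≤ ε / 8 := min_le_right _ _
    linarith
  filter_upwards [eventually_hits_deviates_le hδ0, lt_mem_nhds (by norm_num : (4 : ℝ) < 8)]
    with c h1 h2
  have hΓ := isInvariantGraph_coreGraph h2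
  have e := hΓ.coverEntropy_eq_graphEntropy
  have hnn := Dynamics.coverEntropy_nonneg (planeMap (-1) c) hΓ.nonempty
  have hle := coverEntropy_le_of_hits_deviates_le hΓ.graph hΓ.invariant hz0 hz1 h1
  rw [e] at hnn hle
  have hnn' : 0 ≤ graphEntropy c := by exact_mod_cast hnn
  have hle' := EReal.coe_le_coe_iff.1 hle
  exact ⟨hnn', by linarith⟩

/-- The neighbourhood estimate also holds at 8 itself, so both values lie in [0, ε/2]. -/
lemma continuousAt_graphEntropy : ContinuousAt graphEntropy 8 := by
  rw [Metric.continuousAt_iff']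
  intro ε hε
  have h := eventually_graphEntropy_mem (half_pos hε)
  filter_upwards [h] with c hc
  have h8 := h.self_of_nhds
  rw [Real.dist_eq, abs_lt]
  constructor <;> linarith [hc.1, hc.2, h8.1, h8.2]

end EntropyFunction

/-- There is a well-defined entropy function `h` of `c = -b/a`: the invariant graphs exist for
`c > 4`, and on every invariant graph the topological entropy of the restricted map is `h c`.
This function is continuous at `c = 8`. -/
theorem mainTheorem1 :
    ∃ h : ℝ → ℝ,
      (∀ a b : ℝ, a < 0 → 4 < -b / a → ∃ Γ : Set (ℝ × ℝ), IsInvariantGraph a b Γ) ∧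
      (∀ (a b : ℝ) (Γ : Set (ℝ × ℝ)), a < 0 → IsInvariantGraph a b Γ →
        Dynamics.coverEntropy (planeMap a b) Γ = ((h (-b / a) : ℝ) : EReal)) ∧
      ContinuousAt h 8 := by
  refine ⟨graphEntropy, fun a b ha hc => ?_, fun a b Γ ha hΓ => ?_, continuousAt_graphEntropy⟩
  · have h := (isInvariantGraph_coreGraph hc).smul (neg_pos.2 ha)
    rw [show -a * -1 = a by ring, show -a * (-b / a) = b by have := ha.ne; field_simp] at h
    exact ⟨_, h⟩
  · have hr : 0 < (-a)⁻¹ := inv_pos.2 (neg_pos.2 ha)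
    have h := hΓ.smul hr
    have e := coverEntropy_smul a b Γ hr
    have e1 : (-a)⁻¹ * a = -1 := by
      rw [inv_neg, neg_mul, inv_mul_cancel₀ ha.ne]
    have e2 : (-a)⁻¹ * b = -b / a := by
      rw [inv_neg, neg_mul, neg_div, div_eq_inv_mul]
    rw [e1, e2] at h e
    rw [← e, h.coverEntropy_eq_graphEntropy]
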